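/- Let $\mathbb R_+=[0,\infty)$ and let $\sigma,\tau$ be real-valued functions on $\mathbb R_+$ with $\sigma\in L^2([0,b])$, $\tau\in L^1([0,b])$ for all $b<\infty$; they represent the potential $V=\sigma'+\tau$. An eigensolution at energy $E$ is a function $u\in \mathrm{AC}_{\mathrm{loc}}(\mathbb R_+)$ whose quasiderivative $u^{[1]}=u'-\sigma u$ is in $\mathrm{AC}_{\mathrm{loc}}(\mathbb R_+)$ and for which $-(u^{[1]})'-\sigma u^{[1]}+(\tau-\sigma^2)u=Eu$ a.e. A martingale structure is a family of (possibly empty) intervals $E^m_j\subset\mathbb R_+$, $m\ge 0$, $1\le j\le 2^m$, such that for every $m$ the $E^m_j$ are pairwise disjoint, ordered from left to right, and have union $\mathbb R_+$, and $E^m_j=E^{m+1}_{2j-1}\cup E^{m+1}_{2j}$. For $f\in L^1_{\mathrm{loc}}(\mathbb R_+)$ put $$\|f\|_{\mathcal B_1}=\sum_{m\ge1} m\Big(\sum_{j=1}^{2^m}\Big|\int_{E^m_j}f(x)\,dx\Big|^2\Big)^{1/2}\in[0,\infty],$$ where integrals over unbounded intervals are improper integrals $\lim_{N\to\infty}\int_{E^m_j\cap[0,N]}f$,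 and $\|f\|_{\mathcal B_1}=\infty$ if one of them diverges. Fix $E>0$, set $k=\sqrt E$, $Q=\tau-\sigma^2$, $\tilde Q=Q+2ik\sigma$, $h(x)=2kx-\frac1k\int_0^xQ(t)\,dt$, and $\mathcal F(x,E)=-\frac{i}{2k}e^{-ih(x)}\tilde Q(x)$. For $n\ge 0$ let $$M_n(\mathcal F)(x,x',E)=\int_{x\le t_1\le\cdots\le t_n\le x'}\ \prod_{j=1}^n f_j(t_j)\,dt_1\cdots dt_n,\qquad f_j=\begin{cases}\overline{\mathcal F}(\cdot,E), & n-j \text{ even},\\ \mathcal F(\cdot,E), & n-j\text{ odd}\end{cases}$$ (so $M_0=1$). Suppose that for some martingale structure $$\limsup_{M\to\infty}\|\mathcal F(\cdot,E)\chi_{[M,\infty)}\|_{\mathcal B_1}=0 .$$ Then: 1. For all $n\ge 0$ and $x\ge 0$ the limit $M_n(\mathcal F)(x,\infty,E)=\lim_{x'\to\infty}M_n(\mathcal F)(x,x',E)$ exists, and $\sum_n |M_n(\mathcal F)(x,\infty,E)|<\infty$. 2. The functions $Y_1(x)=1+\sum_{m\ge1}M_{2m}(\mathcal F)(x,\infty,E)$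 and $Y_2(x)=-\sum_{m\ge0}M_{2m+1}(\mathcal F)(x,\infty,E)$ are in $\mathrm{AC}_{\mathrm{loc}}(\mathbb R_+)$, satisfy $Y_1'=\mathcal F\,Y_2$ and $Y_2'=\overline{\mathcal F}\,Y_1$ a.e., and $Y_1(x)\to1$, $Y_2(x)\to0$ as $x\to\infty$. 3. The function $u=e^{ih/2}Y_1+e^{-ih/2}Y_2$ is an eigensolution at energy $E$, with quasiderivative $u^{[1]}=ik\,(e^{ih/2}Y_1-e^{-ih/2}Y_2)$, and as $x\to\infty$ $$u(x)=e^{ikx-\frac{i}{2k}\int_0^x(\tau-\sigma^2)(t)\,dt}+o(1),\qquad u^{[1]}(x)=ik\,e^{ikx-\frac{i}{2k}\int_0^x(\tau-\sigma^2)(t)\,dt}+o(1).$$ 4. If moreover $\sigma\in L^2((0,\infty))$, then there is an eigensolution at energy $E$ with WKB asymptotic behavior: for some constant $c$ with $|c|=1$, the eigensolution $\psi=cu$ satisfies, as $x\to\infty$, $$\psi(x)=e^{ikx-\frac{i}{2k}\int_0^x\tau(t)\,dt}+o(1),\qquad \psi^{[1]}(x)=ik\,e^{ikx-\frac{i}{2k}\int_0^x\tau(t)\,dt}+o(1).$$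 -/

import Mathlib

open MeasureTheory Filter Topology

open scoped ENNReal ComplexConjugate

noncomputable section

namespace WKB

/-! ### The operator and its eigensolutions -/

/-- `f` is locally absolutely continuous on the half-line `[0, ∞)`. -/
def ACLoc (f : ℝ → ℂ) : Prop :=
  ∀ b : ℝ, 0 ≤ b → AbsolutelyContinuousOnInterval f 0 b

/-- `u` is a formal eigensolution at energy `E` of the half-line Schrödinger operator with potential
`V = σ' + τ`, and `v` is (the locally absolutely continuous representative of) its quasiderivative
`u' - σ u`. The last field is the equality `ℓ u = E u`, where `ℓ u = -v' - σ v + (τ - σ²) u`. -/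
structure IsEigensolution (σ τ : ℝ → ℝ) (E : ℝ) (u v : ℝ → ℂ) : Prop where
  ac : ACLoc u
  ac_quasi : ACLoc v
  quasi_eq : ∀ᵐ x : ℝ, 0 < x → v x = deriv u x - (σ x : ℂ) * u x
  eigen_eq : ∀ᵐ x : ℝ, 0 < x →
    -deriv v x - (σ x : ℂ) * v x + ((τ x - σ x ^ 2 : ℝ) : ℂ) * u x = (E : ℂ) * u x

/-- The pair `(u, v)` has the asymptotics
`u = exp (i k x - (i / 2k) ∫₀ˣ ρ) + o(1)`, `v = i k exp (i k x - (i / 2k) ∫₀ˣ ρ) + o(1)`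
as `x → ∞`, where `k = √E`. -/
def HasPhaseAsymptotics (ρ : ℝ → ℝ) (E : ℝ) (u v : ℝ → ℂ) : Prop :=
  Tendsto (fun x : ℝ => u x -
      Complex.exp (Complex.I * (√E * x : ℝ) - Complex.I / (2 * (√E : ℝ)) *
        ((∫ t in (0 : ℝ)..x, ρ t : ℝ) : ℂ))) atTop (𝓝 0) ∧
  Tendsto (fun x : ℝ => v x - Complex.I * (√E : ℝ) *
      Complex.exp (Complex.I * (√E * x : ℝ) - Complex.I / (2 * (√E : ℝ)) *
        ((∫ t in (0 : ℝ)..x, ρ t : ℝ) : ℂ))) atTop (𝓝 0)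

/-- WKB asymptotic behavior of `u` and its quasiderivative `v`: the phase is corrected by `τ`. -/
def HasWKBAsymptotics (τ : ℝ → ℝ) (E : ℝ) (u v : ℝ → ℂ) : Prop :=
  HasPhaseAsymptotics τ E u v

/-! ### The function `𝓕` and the first-order system -/

/-- `Q = τ - σ²`. -/
def Q (σ τ : ℝ → ℝ) (x : ℝ) : ℝ := τ x - σ x ^ 2

/-- `Q̃(x, E) = Q(x) + 2 i k σ(x)`, with `k = √E`. -/
def Qtilde (σ τ : ℝ → ℝ) (E x : ℝ) : ℂ :=
  (Q σ τ x : ℂ) + 2 * Complex.I * (√E : ℝ) * (σ x : ℂ)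

/-- `h(x, E) = 2 k x - ∫₀ˣ Q(t) / k dt`, with `k = √E`. -/
def h (σ τ : ℝ → ℝ) (E x : ℝ) : ℝ :=
  2 * √E * x - ∫ t in (0 : ℝ)..x, Q σ τ t / √E

/-- `𝓕(x, E) = w e^{-i h(x, E)} Q̃(x, E)`, with `w = - i / (2 k)` and `k = √E`. -/
def calF (σ τ : ℝ → ℝ) (E x : ℝ) : ℂ :=
  -(Complex.I / (2 * (√E : ℝ))) * Complex.exp (-(Complex.I * (h σ τ E x : ℝ))) * Qtilde σ τ E x

/-- `Y = (Y₁, Y₂)` is a (locally absolutely continuous) solution on the half-line of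
`Y' = D Y`, where `D` has rows `(0, F)` and `(conj F, 0)`. -/
structure SolvesSystem (F : ℝ → ℂ) (Y₁ Y₂ : ℝ → ℂ) : Prop where
  ac_fst : ACLoc Y₁
  ac_snd : ACLoc Y₂
  deriv_fst : ∀ᵐ x : ℝ, 0 < x → deriv Y₁ x = F x * Y₂ x
  deriv_snd : ∀ᵐ x : ℝ, 0 < x → deriv Y₂ x = conj (F x) * Y₁ x

/-! ### Martingale structures and the seminorms `𝓑_s` -/

/-- A martingale structure on `[0, ∞)`. The intervals of generation `m` are
`I m 0, …, I m (2 ^ m - 1)`, so that `I m j` is the set usually written `E^m_{j+1}`; the values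
`I m j` with `2 ^ m ≤ j` play no role. -/
structure MartingaleStructure where
  I : ℕ → ℕ → Set ℝ
  interval : ∀ m j, j < 2 ^ m → (I m j).OrdConnected
  cover : ∀ m, ⋃ j ∈ Finset.range (2 ^ m), I m j = Set.Ici 0
  disjoint : ∀ m i j, i < 2 ^ m → j < 2 ^ m → i ≠ j → Disjoint (I m i) (I m j)
  ordered : ∀ m i j, i < j → j < 2 ^ m → ∀ x ∈ I m i, ∀ y ∈ I m j, x < y
  split : ∀ m j, j < 2 ^ m → I m j = I (m + 1) (2 * j) ∪ I (m + 1) (2 * j + 1)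

/-- `∫_S f` converges with value `a`, as an improper integral at `+∞`. For a locally integrable `f`
and a bounded `S ⊆ [0, ∞)`, or an integrable `f`, this is the Lebesgue integral. -/
def HasImproperIntegral (f : ℝ → ℂ) (S : Set ℝ) (a : ℂ) : Prop :=
  Tendsto (fun N : ℝ => ∫ x in S ∩ Set.Iic N, f x) atTop (𝓝 a)

/-- The value of `∫_S f` as an improper integral at `+∞` (used only where it converges). -/
def improperIntegral (f : ℝ → ℂ) (S : Set ℝ) : ℂ :=
  limUnder atTop (fun N : ℝ => ∫ x in S ∩ Set.Iic N, f x)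

open Classical in
/-- The seminorm `‖f‖_{𝓑_s} = ∑_{m ≥ 1} m^s (∑_j |∫_{E^m_j} f|²)^{1/2}` (for `s > 0` the term
`m = 0` vanishes) of a locally integrable `f`, with values in `[0, ∞]`; it is `∞` if one of the
integrals does not converge. -/
def bSeminorm (𝓔 : MartingaleStructure) (s : ℝ) (f : ℝ → ℂ) : ℝ≥0∞ :=
  if ∀ m j, j < 2 ^ m → ∃ a, HasImproperIntegral f (𝓔.I m j) a then
    ∑' m : ℕ, (m : ℝ≥0∞) ^ s *
      ENNReal.ofReal (√(∑ j ∈ Finset.range (2 ^ m), ‖improperIntegral f (𝓔.I m j)‖ ^ 2))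
  else ⊤

/-! ### Multilinear operators -/

/-- `M_n(f₁, …, f_n)(x, x') = ∫_{x ≤ t₁ ≤ ⋯ ≤ t_n ≤ x'} ∏ f_j(t_j) dt`. -/
def multilinearM {n : ℕ} (f : Fin n → ℝ → ℂ) (x x' : ℝ) : ℂ :=
  ∫ t in {t : Fin n → ℝ | Monotone t ∧ ∀ i, t i ∈ Set.Icc x x'}, ∏ i, f i (t i)

/-- The `n` alternating factors `…, F, conj F, F, conj F`, the last one being `conj F`. -/
def alternating (F : ℝ → ℂ) (n : ℕ) (i : Fin n) (t : ℝ) : ℂ :=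
  if Even (n - (i : ℕ)) then F t else conj (F t)

/-- `M_n(F)(x, x')` with alternating factors: `M_n(F, conj F, …, F, conj F)` for even `n` and
`M_n(conj F, F, …, F, conj F)` for odd `n`. -/
def multilinearAlt (F : ℝ → ℂ) (n : ℕ) (x x' : ℝ) : ℂ :=
  multilinearM (alternating F n) x x'

end WKB

end

/-!
The point of the proof is that only the smallness of the tails of `F = 𝓕(·, E)` in `𝓑₁` matters,
and that the weights in this seminorm are not needed once *all* tails are known to be small.

Write `M_n(x, y)` for the alternating iterated integrals of `F` (`iter`). Cutting the simplex at a
point `y` between `x` and `z` expresses `M_n(x, z)` through products `M_k(x, y) M_{n-k}(y, z)`, up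
to complex conjugations (`iter_eq_sum_antidiagonal`). Hence the sum `T` of the absolute values of
all terms of order `n ≥ 2` is almost additive: with `l(x, y) = |∫_x^y F|`,
`T(x, z) ≤ T(x, y) + T(y, z) + (l(x, y) + T(x, y)) (l(y, z) + T(y, z))` (`higherOrder_le`).
If `T ≤ exp b₁² - 1` and `T ≤ exp b₂² - 1` on two neighbouring intervals, it follows that
`T ≤ exp b² - 1` on their union, where `b = √(l₁² + l₂²) + √(b₁² + b₂²)`
(`le_exp_sq_sub_one_of_concat`). Climbing from the leaves of the martingale structure to the root,
and using Minkowski's inequality in each generation, one finds `T(x, y) ≤ exp β² - 1`, where `β` is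
the sum over the generations of the `ℓ²` norms of the increments of `F` over the traces of the
intervals on `[x, y)` (`higherOrder_le_of_dyadic`). The leaves contribute nothing in the limit
because, by compactness, the intervals of the structure shrink to points or to intervals on which
`F` vanishes almost everywhere (`exists_mesh_le`): an interval that is never divided contributes the
same amount to every generation.

As `F χ_[x, y) = F χ_[x, ∞) - F χ_[y, ∞)`, the number `β` is at most the sum of the seminorms of two
tails (`sum_increments_le`), so that `∑_{n ≥ 1} |M_n(x, y)|` tends to zero as `x → ∞`, uniformly in
`y` (`smallAtInfinity_of_limsup`). Together with the factorial bound for the integrable function `F`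
on bounded intervals, this yields the limits `y → ∞`, the absolute convergence of the series, and
through dominated convergence the integral equations of the first-order system and the behavior of
its solution at infinity. The function `u` and its quasiderivative are then differentiated by hand,
and for square integrable `σ` the phase `∫₀ˣ σ²` converges and is absorbed into a constant.
-/

namespace WKB

/-! ### Iterated integrals and their concatenation -/

theorem _root_.MeasureTheory.LocallyIntegrable.intervalIntegrable' {E : Type*}
    [NormedAddCommGroup E] {f : ℝ → E} (hf : LocallyIntegrable f) (a b : ℝ) :
    IntervalIntegrable f volume a b :=
  intervalIntegrable_iff.mpr
    ((hf.integrableOn_isCompact isCompact_uIcc).mono_set Set.uIoc_subset_uIcc)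

theorem _root_.MeasureTheory.LocallyIntegrable.norm {E : Type*}
    [NormedAddCommGroup E] {f : ℝ → E} (hf : LocallyIntegrable f) :
    LocallyIntegrable fun x => ‖f x‖ := by
  rw [locallyIntegrable_iff] at hf ⊢
  exact fun k hk => (hf k hk).norm

theorem continuous_integral_left {E : Type*} [NormedAddCommGroup E] [NormedSpace ℝ E]
    {f : ℝ → E} (hf : ∀ a b, IntervalIntegrable f volume a b) (y : ℝ) :
    Continuous fun x => ∫ t in x..y, f t := by
  simp only [fun x => intervalIntegral.integral_symm (f := f) (μ := volume) y x]
  exact (intervalIntegral.continuous_primitive hf y).neg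

/-- Complex conjugation composed with itself `m` times. -/
noncomputable def twist (m : ℕ) : ℂ →+* ℂ := if Even m then RingHom.id ℂ else starRingEnd ℂ

theorem twist_of_even {m : ℕ} (hm : Even m) (z : ℂ) : twist m z = z := by simp [twist, hm]

theorem twist_of_odd {m : ℕ} (hm : ¬ Even m) (z : ℂ) : twist m z = conj z := by simp [twist, hm]

@[simp] theorem twist_zero (z : ℂ) : twist 0 z = z := twist_of_even (by simp) z

@[simp] theorem norm_twist (m : ℕ) (z : ℂ) : ‖twist m z‖ = ‖z‖ := by
  by_cases hm : Even m
  · rw [twist_of_even hm]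
  · rw [twist_of_odd hm, RCLike.norm_conj]

theorem twist_twist (m n : ℕ) (z : ℂ) : twist m (twist n z) = twist (m + n) z := by
  by_cases hm : Even m <;> by_cases hn : Even n <;>
    simp [twist, Nat.even_add, hm, hn]

theorem continuous_twist (m : ℕ) : Continuous (twist m) := by
  by_cases hm : Even m
  · rw [show ⇑(twist m) = id from funext (twist_of_even hm)]; exact continuous_id
  · simpa only [funext (twist_of_odd hm)] using Complex.continuous_conj

theorem twist_intervalIntegral (m : ℕ) (f : ℝ → ℂ) (a b : ℝ) :
    twist m (∫ t in a..b, f t) = ∫ t in a..b, twist m (f t) := by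
  by_cases hm : Even m
  · simp only [twist_of_even hm]
  · simp only [twist_of_odd hm, intervalIntegral, map_sub, integral_conj]

theorem _root_.MeasureTheory.LocallyIntegrable.twist {F : ℝ → ℂ} (hF : LocallyIntegrable F)
    (m : ℕ) : LocallyIntegrable fun t => twist m (F t) := by
  rw [locallyIntegrable_iff] at hF ⊢
  intro k hk
  refine (hF k hk).congr' ?_ ?_
  · exact (continuous_twist m).comp_aestronglyMeasurable (hF k hk).aestronglyMeasurable
  · exact Eventually.of_forall fun t => (norm_twist m _).symm

/-- The iterated integral of `⋯ F(t_{n-1}) conj F(t_n)` over `x ≤ t₁ ≤ ⋯ ≤ t_n ≤ y`, with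
alternating factors of which the last is `conj F`, defined by recursion on the number of factors.
Unlike the integral over a simplex, it is an oriented integral, so that its splitting rules hold for all
endpoints. -/
noncomputable def iter (F : ℝ → ℂ) : ℕ → ℝ → ℝ → ℂ
  | 0, _, _ => 1
  | n + 1, x, y => ∫ t in x..y, twist (n + 1) (F t) * iter F n t y

theorem iter_zero (F : ℝ → ℂ) (x y : ℝ) : iter F 0 x y = 1 := rfl

theorem iter_succ (F : ℝ → ℂ) (n : ℕ) (x y : ℝ) :
    iter F (n + 1) x y = ∫ t in x..y, twist (n + 1) (F t) * iter F n t y := rfl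

section

variable {F : ℝ → ℂ} (hF : LocallyIntegrable F)
include hF

theorem continuous_iter (n : ℕ) (y : ℝ) : Continuous fun x => iter F n x y := by
  induction n with
  | zero => simpa only [iter_zero] using continuous_const
  | succ n ih =>
    simp only [iter_succ]
    exact continuous_integral_left (fun a b =>
      ((hF.twist (n + 1)).intervalIntegrable' a b).mul_continuousOn ih.continuousOn) y

theorem intervalIntegrable_twist_mul_iter (m n : ℕ) (y a b : ℝ) :
    IntervalIntegrable (fun t => twist m (F t) * iter F n t y) volume a b :=
  ((hF.twist m).intervalIntegrable' a b).mul_continuousOn (continuous_iter hF n y).continuousOn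

theorem iter_succ_eq_add (n : ℕ) (x y z : ℝ) :
    iter F (n + 1) x z = (∫ t in x..y, twist (n + 1) (F t) * iter F n t z) +
      iter F (n + 1) y z := by
  rw [iter_succ, iter_succ, intervalIntegral.integral_add_adjacent_intervals] <;>
  exact intervalIntegrable_twist_mul_iter hF _ _ _ _ _

/-- Splitting the simplex according to the number of variables below the point `y`. -/
theorem iter_eq_sum_antidiagonal (n : ℕ) (x y z : ℝ) :
    iter F n x z = ∑ p ∈ Finset.HasAntidiagonal.antidiagonal n,
      twist p.2 (iter F p.1 x y) * iter F p.2 y z := by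
  induction n generalizing x with
  | zero => simp [iter_zero]
  | succ n ih =>
    rw [iter_succ_eq_add hF n x y z, Finset.Nat.sum_antidiagonal_succ, add_comm]
    simp only [iter_zero, map_one, one_mul]
    congr 1
    simp_rw [fun t => ih t, Finset.mul_sum]
    rw [intervalIntegral.integral_finsetSum]
    · refine Finset.sum_congr rfl fun p hp => ?_
      have hp' : p.1 + p.2 = n := by simpa using hp
      rw [iter_succ, twist_intervalIntegral, ← intervalIntegral.integral_mul_const]
      refine intervalIntegral.integral_congr fun t _ => ?_
      simp only [map_mul, twist_twist]
      rw [show p.2 + (p.1 + 1) = n + 1 by omega, mul_assoc]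
    · intro p hp
      refine ((hF.twist _).intervalIntegrable' _ _).mul_continuousOn (Continuous.continuousOn ?_)
      exact ((continuous_twist _).comp (continuous_iter hF _ _)).mul continuous_const

theorem norm_iter_le_sum_antidiagonal (n : ℕ) (x y z : ℝ) :
    ‖iter F n x z‖ ≤ ∑ p ∈ Finset.HasAntidiagonal.antidiagonal n,
      ‖iter F p.1 x y‖ * ‖iter F p.2 y z‖ := by
  rw [iter_eq_sum_antidiagonal hF n x y z]
  refine (norm_sum_le _ _).trans (Finset.sum_le_sum fun p _ => ?_)
  rw [norm_mul, norm_twist]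

end

/-- The primitive of a locally integrable function is absolutely continuous. -/
theorem absolutelyContinuousOnInterval_primitive {φ : ℝ → ℝ} (hφ : LocallyIntegrable φ)
    (a b c : ℝ) : AbsolutelyContinuousOnInterval (fun x => ∫ t in c..x, φ t) a b := by
  have h := ((hφ.intervalIntegrable'  (min (min a b) c) (max (max a b) c)
    ).absolutelyContinuousOnInterval_intervalIntegral (c := c)
    (by rw [Set.uIcc_of_le (by simp)]; simp))
  refine h.mono ?_
  rw [Set.uIcc_of_le (a := min (min a b) c) (by simp), Set.uIcc]
  exact Set.Icc_subset_Icc (by simp) (by simp)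

theorem _root_.AbsolutelyContinuousOnInterval.pow_succ {f : ℝ → ℝ} {a b : ℝ}
    (hf : AbsolutelyContinuousOnInterval f a b) (n : ℕ) :
    AbsolutelyContinuousOnInterval (fun x => f x ^ (n + 1)) a b := by
  induction n with
  | zero => simpa using hf
  | succ n ih => simpa only [_root_.pow_succ _ (n + 1)] using ih.fun_mul hf

/-- The fundamental theorem of calculus for the absolutely continuous function
`t ↦ (∫ s in t..y, φ s) ^ (n + 1)`. -/
theorem integral_mul_pow_integral {φ : ℝ → ℝ} (hφ : LocallyIntegrable φ) (n : ℕ) (x y : ℝ) :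
    ∫ t in x..y, φ t * (∫ s in t..y, φ s) ^ n = (∫ t in x..y, φ t) ^ (n + 1) / (n + 1) := by
  set G : ℝ → ℝ := fun t => ∫ s in t..y, φ s with hG
  have hG' : G = fun t => -∫ s in y..t, φ s :=
    funext fun t => intervalIntegral.integral_symm _ _
  have hac : AbsolutelyContinuousOnInterval G x y := by
    rw [hG']; exact (absolutelyContinuousOnInterval_primitive hφ x y y).fun_neg
  have key := (hac.pow_succ n).integral_deriv_eq_sub
  have hd : ∫ t in x..y, deriv (fun t => G t ^ (n + 1)) t =
      ∫ t in x..y, (-(n + 1 : ℝ)) * (φ t * G t ^ n) := by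
    refine intervalIntegral.integral_congr_ae ?_
    filter_upwards [_root_.LocallyIntegrable.ae_hasDerivAt_integral hφ] with t ht _
    have h1 : HasDerivAt G (-φ t) t := by rw [hG']; exact (ht y).neg
    have h2 := (h1.pow (n + 1)).deriv
    simp only [Pi.pow_def] at h2
    rw [h2]; push_cast; simp; ring
  have hGy : G y = 0 := by simp [hG]
  rw [hd, intervalIntegral.integral_const_mul, hGy] at key
  have hn : (n + 1 : ℝ) ≠ 0 := by positivity
  rw [eq_div_iff hn]
  simp at key
  change _ = G x ^ (n + 1)
  linarith

/-- The factorial bound, by induction on the number of factors. -/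
theorem norm_iter_le {F : ℝ → ℂ} (hF : LocallyIntegrable F) (n : ℕ) {x y : ℝ} (hxy : x ≤ y) :
    ‖iter F n x y‖ ≤ (∫ t in x..y, ‖F t‖) ^ n / n.factorial := by
  induction n generalizing x with
  | zero => simp [iter_zero]
  | succ n ih =>
    have hc : Continuous fun t => (∫ s in t..y, ‖F s‖) ^ n / n.factorial := by
      have := continuous_integral_left hF.norm.intervalIntegrable' y
      fun_prop
    calc ‖iter F (n + 1) x y‖
        ≤ ∫ t in x..y, ‖F t‖ * ((∫ s in t..y, ‖F s‖) ^ n / n.factorial) := by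
          rw [iter_succ]
          refine intervalIntegral.norm_integral_le_of_norm_le hxy ?_
            ((hF.norm.intervalIntegrable' x y).mul_continuousOn hc.continuousOn)
          refine Eventually.of_forall fun t ht => ?_
          rw [norm_mul, norm_twist]
          exact mul_le_mul_of_nonneg_left (ih ht.2) (norm_nonneg _)
      _ = (∫ t in x..y, ‖F t‖) ^ (n + 1) / (n + 1).factorial := by
          simp_rw [← mul_div_assoc]
          rw [intervalIntegral.integral_div, integral_mul_pow_integral hF.norm, Nat.factorial_succ]
          push_cast
          rw [div_div]

theorem integral_norm_nonneg (F : ℝ → ℂ) {x y : ℝ} (hxy : x ≤ y) : 0 ≤ ∫ t in x..y, ‖F t‖ :=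
  intervalIntegral.integral_nonneg hxy fun _ _ => norm_nonneg _

theorem summable_norm_iter {F : ℝ → ℂ} (hF : LocallyIntegrable F) {x y : ℝ} (hxy : x ≤ y) :
    Summable fun n => ‖iter F n x y‖ :=
  Summable.of_nonneg_of_le (fun _ => norm_nonneg _) (fun n => norm_iter_le hF n hxy)
    (Real.summable_pow_div_factorial _)

theorem tsum_norm_iter_le_exp {F : ℝ → ℂ} (hF : LocallyIntegrable F) {x y : ℝ} (hxy : x ≤ y) :
    ∑' n, ‖iter F n x y‖ ≤ Real.exp (∫ t in x..y, ‖F t‖) := by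
  rw [Real.exp_eq_exp_ℝ, NormedSpace.exp_eq_tsum_div]
  exact (summable_norm_iter hF hxy).tsum_le_tsum (fun n => norm_iter_le hF n hxy)
    (Real.summable_pow_div_factorial _)

/-- The sum over `n` of the iterated integrals is submultiplicative under concatenation. -/
theorem tsum_norm_iter_le_mul {F : ℝ → ℂ} (hF : LocallyIntegrable F) {x y z : ℝ} (hxy : x ≤ y)
    (hyz : y ≤ z) :
    ∑' n, ‖iter F n x z‖ ≤ (∑' n, ‖iter F n x y‖) * ∑' n, ‖iter F n y z‖ := by
  have h1 : Summable fun n => ‖‖iter F n x y‖‖ := by simpa using summable_norm_iter hF hxy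
  have h2 : Summable fun n => ‖‖iter F n y z‖‖ := by simpa using summable_norm_iter hF hyz
  rw [tsum_mul_tsum_eq_tsum_sum_antidiagonal_of_summable_norm h1 h2]
  exact (summable_norm_iter hF (hxy.trans hyz)).tsum_le_tsum
    (fun n => norm_iter_le_sum_antidiagonal hF n x y z)
    (summable_norm_sum_mul_antidiagonal_of_summable_norm h1 h2).of_norm

/-- The total size of the iterated integrals of order at least two. -/
noncomputable def higherOrder (F : ℝ → ℂ) (x y : ℝ) : ℝ := ∑' n, ‖iter F (n + 2) x y‖

theorem higherOrder_nonneg (F : ℝ → ℂ) (x y : ℝ) : 0 ≤ higherOrder F x y :=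
  tsum_nonneg fun _ => norm_nonneg _

theorem norm_iter_one (F : ℝ → ℂ) (x y : ℝ) : ‖iter F 1 x y‖ = ‖∫ t in x..y, F t‖ := by
  rw [← norm_twist 1 (∫ t in x..y, F t), twist_intervalIntegral]
  simp [iter_succ, iter_zero]

theorem tsum_norm_iter_eq {F : ℝ → ℂ} (hF : LocallyIntegrable F) {x y : ℝ} (hxy : x ≤ y) :
    ∑' n, ‖iter F n x y‖ = 1 + ‖∫ t in x..y, F t‖ + higherOrder F x y := by
  rw [← (summable_norm_iter hF hxy).sum_add_tsum_nat_add 2, Finset.sum_range_succ,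
    Finset.sum_range_one, iter_zero, norm_iter_one, norm_one]
  rfl

/-- The quadratic defect of additivity of the higher order terms under concatenation. -/
theorem higherOrder_le {F : ℝ → ℂ} (hF : LocallyIntegrable F) {x y z : ℝ} (hxy : x ≤ y)
    (hyz : y ≤ z) :
    higherOrder F x z ≤ higherOrder F x y + higherOrder F y z +
      (‖∫ t in x..y, F t‖ + higherOrder F x y) * (‖∫ t in y..z, F t‖ + higherOrder F y z) := by
  have h1 : Summable fun n => ‖‖iter F n x y‖‖ := by simpa using summable_norm_iter hF hxy
  have h2 : Summable fun n => ‖‖iter F n y z‖‖ := by simpa using summable_norm_iter hF hyz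
  set c : ℕ → ℝ := fun n => ∑ p ∈ Finset.HasAntidiagonal.antidiagonal n,
    ‖iter F p.1 x y‖ * ‖iter F p.2 y z‖ with hc
  have h3 : Summable c := (summable_norm_sum_mul_antidiagonal_of_summable_norm h1 h2).of_norm
  have h4 := tsum_mul_tsum_eq_tsum_sum_antidiagonal_of_summable_norm h1 h2
  have hc0 : c 0 = 1 := by simp [hc, iter_zero]
  have hc1 : c 1 = ‖∫ t in y..z, F t‖ + ‖∫ t in x..y, F t‖ := by
    simp [hc, Finset.Nat.sum_antidiagonal_succ, iter_zero, norm_iter_one]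
  rw [← h3.sum_add_tsum_nat_add 2, Finset.sum_range_succ, Finset.sum_range_one, hc0, hc1,
    tsum_norm_iter_eq hF hxy, tsum_norm_iter_eq hF hyz] at h4
  have h5 : higherOrder F x z ≤ ∑' n, c (n + 2) :=
    ((summable_nat_add_iff 2).mpr (summable_norm_iter hF (hxy.trans hyz))).tsum_le_tsum
      (fun n => norm_iter_le_sum_antidiagonal hF (n + 2) x y z)
      ((summable_nat_add_iff 2).mpr h3)
  linarith

theorem higherOrder_le_sq_mul_exp {F : ℝ → ℂ} (hF : LocallyIntegrable F) {x y : ℝ} (hxy : x ≤ y) :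
    higherOrder F x y ≤ (∫ t in x..y, ‖F t‖) ^ 2 * Real.exp (∫ t in x..y, ‖F t‖) := by
  set A := ∫ t in x..y, ‖F t‖
  have hA : 0 ≤ A := integral_norm_nonneg F hxy
  rw [Real.exp_eq_exp_ℝ, NormedSpace.exp_eq_tsum_div, ← tsum_mul_left]
  refine ((summable_nat_add_iff 2).mpr (summable_norm_iter hF hxy)).tsum_le_tsum (fun n => ?_)
    ((Real.summable_pow_div_factorial _).mul_left _)
  refine (norm_iter_le hF (n + 2) hxy).trans ?_
  rw [← mul_div_assoc, ← pow_add, add_comm n 2]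
  have : n.factorial ≤ (2 + n).factorial := Nat.factorial_le (by omega)
  exact div_le_div_of_nonneg_left (by positivity) (by positivity) (by exact_mod_cast this)

/-! ### Iterated integrals as integrals over simplices -/

/-- The simplex over which `multilinearM` integrates. -/
def simplex (n : ℕ) (x y : ℝ) : Set (Fin n → ℝ) := {t | Monotone t ∧ ∀ i, t i ∈ Set.Icc x y}

theorem measurableSet_simplex (n : ℕ) (x y : ℝ) : MeasurableSet (simplex n x y) := by
  refine IsClosed.measurableSet ?_
  have : simplex n x y = {t | Monotone t} ∩ ⋂ i, (fun t => t i) ⁻¹' Set.Icc x y := by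
    ext t; simp [simplex]
  rw [this]
  refine isClosed_monotone.inter (isClosed_iInter fun i => ?_)
  exact isClosed_Icc.preimage (continuous_apply i)

theorem cons_mem_simplex {n : ℕ} {x y a : ℝ} {s : Fin n → ℝ} :
    (Fin.cons a s : Fin (n + 1) → ℝ) ∈ simplex (n + 1) x y ↔
      a ∈ Set.Icc x y ∧ s ∈ simplex n a y := by
  constructor
  · rintro ⟨hm, hI⟩
    refine ⟨by simpa using hI 0, fun i j hij => ?_, fun i => ⟨?_, ?_⟩⟩
    · simpa using hm (Fin.succ_le_succ_iff.mpr hij)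
    · simpa using hm (Fin.zero_le i.succ)
    · simpa using (hI i.succ).2
  · rintro ⟨ha, hm, hI⟩
    refine ⟨fun i j hij => ?_, fun i => ?_⟩
    · induction i using Fin.cases with
      | zero =>
        induction j using Fin.cases with
        | zero => simp
        | succ j => simpa using (hI j).1
      | succ i =>
        induction j using Fin.cases with
        | zero => simp at hij
        | succ j => simpa using hm (Fin.succ_le_succ_iff.mp hij)
    · induction i using Fin.cases with
      | zero => simpa using ha
      | succ i => simpa using ⟨ha.1.trans (hI i).1, (hI i).2⟩

theorem multilinearM_eq_integral_indicator {n : ℕ} (f : Fin n → ℝ → ℂ) (x y : ℝ) :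
    multilinearM f x y = ∫ t, (simplex n x y).indicator (fun t => ∏ i, f i (t i)) t :=
  (integral_indicator (measurableSet_simplex n x y)).symm

theorem integrable_indicator_simplex {n : ℕ} {f : Fin n → ℝ → ℂ} {x y : ℝ}
    (hf : ∀ i, IntegrableOn (f i) (Set.Icc x y)) :
    Integrable ((simplex n x y).indicator fun t => ∏ i, f i (t i)) := by
  have h1 : Integrable fun t : Fin n → ℝ => ∏ i, (Set.Icc x y).indicator (f i) (t i) :=
    Integrable.fintype_prod fun i => (integrable_indicator_iff measurableSet_Icc).mpr (hf i)
  refine (h1.indicator (measurableSet_simplex n x y)).congr (Eventually.of_forall fun t => ?_)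
  by_cases ht : t ∈ simplex n x y
  · simp only [Set.indicator_of_mem ht]
    exact Finset.prod_congr rfl fun i _ => Set.indicator_of_mem (ht.2 i) _
  · simp only [Set.indicator_of_notMem ht]

theorem multilinearM_zero (f : Fin 0 → ℝ → ℂ) (x y : ℝ) : multilinearM f x y = 1 := by
  rw [multilinearM]
  have : {t : Fin 0 → ℝ | Monotone t ∧ ∀ i, t i ∈ Set.Icc x y} = Set.univ := by
    ext t; simp [Subsingleton.monotone]
  rw [this]
  simp [measureReal_def, volume_pi]

/-- Fubini's theorem on the simplex, the smallest variable being integrated last. -/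
theorem multilinearM_succ {n : ℕ} {f : Fin (n + 1) → ℝ → ℂ} {x y : ℝ} (hxy : x ≤ y)
    (hf : ∀ i, IntegrableOn (f i) (Set.Icc x y)) :
    multilinearM f x y = ∫ a in x..y, f 0 a * multilinearM (fun i => f i.succ) a y := by
  have hint := integrable_indicator_simplex hf
  have hmp := (volume_preserving_piFinSuccAbove (fun _ : Fin (n + 1) => ℝ) 0).symm
  have hcons : ∀ p : ℝ × (Fin n → ℝ),
      (MeasurableEquiv.piFinSuccAbove (fun _ : Fin (n + 1) => ℝ) 0).symm p =
        Fin.cons p.1 p.2 := fun p => by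
    simp [MeasurableEquiv.piFinSuccAbove, Fin.insertNthEquiv]
  have hpt : ∀ (a : ℝ) (s : Fin n → ℝ),
      (simplex (n + 1) x y).indicator (fun t => ∏ i, f i (t i)) (Fin.cons a s) =
        (Set.Icc x y).indicator (f 0) a *
          (simplex n a y).indicator (fun s => ∏ i : Fin n, f i.succ (s i)) s := by
    intro a s
    by_cases ha : a ∈ Set.Icc x y <;> by_cases hs : s ∈ simplex n a y
    · rw [Set.indicator_of_mem (cons_mem_simplex.mpr ⟨ha, hs⟩), Set.indicator_of_mem ha,
        Set.indicator_of_mem hs, Fin.prod_univ_succ]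
      simp
    all_goals
      rw [Set.indicator_of_notMem fun h => ?_]
      · simp [ha, hs]
      · have := cons_mem_simplex.mp h
        tauto
  rw [multilinearM_eq_integral_indicator, ← hmp.integral_comp
    (MeasurableEquiv.measurableEmbedding _)]
  have hint' := (hmp.integrable_comp_emb (MeasurableEquiv.measurableEmbedding _)).mpr hint
  simp only [Function.comp_def] at hint'
  rw [Measure.volume_eq_prod, integral_prod _ hint']
  simp only [hcons, hpt, integral_const_mul]
  simp only [← multilinearM_eq_integral_indicator]
  rw [intervalIntegral.integral_of_le hxy, ← integral_Icc_eq_integral_Ioc,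
    ← integral_indicator measurableSet_Icc]
  refine integral_congr_ae (Eventually.of_forall fun a => ?_)
  by_cases ha : a ∈ Set.Icc x y <;> simp [ha]

theorem alternating_eq_twist (F : ℝ → ℂ) (n : ℕ) (i : Fin n) (t : ℝ) :
    alternating F n i t = twist (n - i) (F t) := by
  unfold alternating twist
  split_ifs <;> rfl

/-- The iterated integrals are the alternating multilinear operators. -/
theorem multilinearAlt_eq_iter {F : ℝ → ℂ} (hF : LocallyIntegrable F) (n : ℕ) {x y : ℝ}
    (hxy : x ≤ y) : multilinearAlt F n x y = iter F n x y := by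
  induction n generalizing x with
  | zero => exact multilinearM_zero _ _ _
  | succ n ih =>
    rw [multilinearAlt, multilinearM_succ hxy, iter_succ]
    · refine intervalIntegral.integral_congr fun t ht => ?_
      rw [Set.uIcc_of_le hxy] at ht
      simp only [alternating_eq_twist, Fin.val_zero, Nat.sub_zero]
      rw [← ih ht.2, multilinearAlt]
      congr 2
      ext i s
      rw [alternating_eq_twist, alternating_eq_twist, Fin.val_succ, Nat.add_sub_add_right]
    · intro i
      have := (hF.twist (n + 1 - i)).integrableOn_isCompact (isCompact_Icc (a := x) (b := y))
      exact this.congr_fun (fun t _ => (alternating_eq_twist F _ i t).symm) measurableSet_Icc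

/-! ### Gluing along a dyadic tree -/

theorem sqrt_sum_sq_add_le {ι : Type*} (s : Finset ι) (a b : ι → ℝ) :
    √(∑ i ∈ s, (a i + b i) ^ 2) ≤ √(∑ i ∈ s, a i ^ 2) + √(∑ i ∈ s, b i ^ 2) := by
  have := Real.Lp_add_le s a b (p := 2) (by norm_num)
  simpa only [Real.rpow_two, sq_abs, ← Real.sqrt_eq_rpow] using this

theorem sum_range_two_mul (a : ℕ → ℝ) (n : ℕ) :
    ∑ j ∈ Finset.range (2 * n), a j = ∑ j ∈ Finset.range n, (a (2 * j) + a (2 * j + 1)) := by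
  induction n with
  | zero => simp
  | succ n ih => rw [Nat.mul_succ, Finset.sum_range_succ, Finset.sum_range_succ, ih,
      Finset.sum_range_succ, add_assoc]

/-- Gluing two neighbouring intervals: bounds `exp b² - 1` on the two parts give a bound of the
same form on the union, where only the first order increments `l₁`, `l₂` add to the exponent. -/
theorem le_exp_sq_sub_one_of_concat {s s₁ s₂ l₁ l₂ b₁ b₂ : ℝ} (hl₁ : 0 ≤ l₁) (hl₂ : 0 ≤ l₂)
    (hs₁ : 0 ≤ s₁) (hs₂ : 0 ≤ s₂)
    (h₁ : s₁ ≤ Real.exp (b₁ ^ 2) - 1) (h₂ : s₂ ≤ Real.exp (b₂ ^ 2) - 1)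
    (h : s ≤ s₁ + s₂ + (l₁ + s₁) * (l₂ + s₂)) :
    s ≤ Real.exp ((√(l₁ ^ 2 + l₂ ^ 2) + √(b₁ ^ 2 + b₂ ^ 2)) ^ 2) - 1 := by
  set L := √(l₁ ^ 2 + l₂ ^ 2) with hL
  set B := √(b₁ ^ 2 + b₂ ^ 2) with hB
  have hL0 : 0 ≤ L := Real.sqrt_nonneg _
  have hB0 : 0 ≤ B := Real.sqrt_nonneg _
  have hL2 : L ^ 2 = l₁ ^ 2 + l₂ ^ 2 := Real.sq_sqrt (by positivity)
  have hB2 : B ^ 2 = b₁ ^ 2 + b₂ ^ 2 := Real.sq_sqrt (by positivity)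
  have hl₁L : l₁ ≤ L := Real.le_sqrt_of_sq_le (by nlinarith)
  have hl₂L : l₂ ≤ L := Real.le_sqrt_of_sq_le (by nlinarith)
  set e₁ := Real.exp (b₁ ^ 2)
  set e₂ := Real.exp (b₂ ^ 2)
  set P := Real.exp (B ^ 2) with hP
  have he₁ : 1 ≤ e₁ := Real.one_le_exp (by positivity)
  have he₂ : 1 ≤ e₂ := Real.one_le_exp (by positivity)
  have hPe : P = e₁ * e₂ := by rw [hP, hB2, Real.exp_add]
  have hP1 : 1 ≤ P := Real.one_le_exp (by positivity)
  have hprod : (l₁ + s₁) * (l₂ + s₂) ≤ (l₁ + (e₁ - 1)) * (l₂ + (e₂ - 1)) :=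
    mul_le_mul (by linarith) (by linarith) (by linarith) (by linarith)
  have hsum : l₁ * (e₂ - 1) + l₂ * (e₁ - 1) ≤ L * (P - 1) := by
    have h3 : l₁ * (e₂ - 1) ≤ L * (e₂ - 1) := mul_le_mul_of_nonneg_right hl₁L (by linarith)
    have h4 : l₂ * (e₁ - 1) ≤ L * (e₁ - 1) := mul_le_mul_of_nonneg_right hl₂L (by linarith)
    have h5 : (e₁ - 1) + (e₂ - 1) ≤ P - 1 := by nlinarith
    have h6 := mul_le_mul_of_nonneg_left h5 hL0
    linarith
  have hll : l₁ * l₂ ≤ L ^ 2 := by nlinarith [sq_nonneg (l₁ - l₂)]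
  -- `exp B² - 1` is at most linear in `B` relative to `exp B²`, for large and for small `B`
  have hPB : P - 1 ≤ 2 * B * P := by
    rcases le_or_gt 1 B with hB1 | hB1
    · nlinarith
    · have h7 : 1 - B ^ 2 ≤ Real.exp (-B ^ 2) := by
        have := Real.add_one_le_exp (-B ^ 2); linarith
      have h8 : Real.exp (-B ^ 2) * P = 1 := by rw [hP, ← Real.exp_add]; simp
      have h9 : (1 - B ^ 2) * P ≤ 1 :=
        (mul_le_mul_of_nonneg_right h7 (by linarith)).trans h8.le
      have h10 : B ^ 2 * P ≤ B * P := mul_le_mul_of_nonneg_right (by nlinarith) (by linarith)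
      have h11 : 0 ≤ B * P := by positivity
      linarith
  have hexp : P * (1 + (L ^ 2 + 2 * L * B)) ≤ Real.exp ((L + B) ^ 2) := by
    have : (L + B) ^ 2 = B ^ 2 + (L ^ 2 + 2 * L * B) := by ring
    rw [this, Real.exp_add]
    refine mul_le_mul_of_nonneg_left ?_ (by linarith)
    have := Real.add_one_le_exp (L ^ 2 + 2 * L * B)
    linarith
  have h12 := mul_le_mul_of_nonneg_left hPB hL0
  have h13 : L ^ 2 ≤ P * L ^ 2 := le_mul_of_one_le_left (by positivity) hP1
  have h14 : e₁ + e₂ - 2 + (l₁ + (e₁ - 1)) * (l₂ + (e₂ - 1)) =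
      e₁ * e₂ - 1 + l₁ * l₂ + (l₁ * (e₂ - 1) + l₂ * (e₁ - 1)) := by ring
  nlinarith

/-- Gluing along a dyadic tree of intervals: the bounds `exp b² - 1` are carried from the leaves of
generation `m + k` up to generation `m`, and Minkowski's inequality controls the `ℓ²` norm of the
exponents in each generation. -/
theorem exists_dyadic_bound {s l : ℝ → ℝ → ℝ} (hs : ∀ x y, 0 ≤ s x y) (hl : ∀ x y, 0 ≤ l x y)
    (hsl : ∀ x y z, x ≤ y → y ≤ z → s x z ≤ s x y + s y z + (l x y + s x y) * (l y z + s y z))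
    {p : ℕ → ℕ → ℝ} (hp : ∀ m, Monotone (p m)) (hp' : ∀ m j, p (m + 1) (2 * j) = p m j) (k m : ℕ) :
    ∃ b : ℕ → ℝ, (∀ j, s (p m j) (p m (j + 1)) ≤ Real.exp (b j ^ 2) - 1) ∧
      √(∑ j ∈ Finset.range (2 ^ m), b j ^ 2) ≤
        (∑ i ∈ Finset.range k,
          √(∑ j ∈ Finset.range (2 ^ (m + i + 1)),
            l (p (m + i + 1) j) (p (m + i + 1) (j + 1)) ^ 2)) +
        √(∑ j ∈ Finset.range (2 ^ (m + k)), s (p (m + k) j) (p (m + k) (j + 1))) := by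
  induction k generalizing m with
  | zero =>
    refine ⟨fun j => √(s (p m j) (p m (j + 1))), fun j => ?_, ?_⟩
    · rw [Real.sq_sqrt (hs _ _)]
      linarith [Real.add_one_le_exp (s (p m j) (p m (j + 1)))]
    · simp [Real.sq_sqrt (hs _ _)]
  | succ k ih =>
    obtain ⟨b, hb, hbs⟩ := ih (m + 1)
    set c : ℕ → ℝ := fun j => l (p (m + 1) j) (p (m + 1) (j + 1)) with hc
    refine ⟨fun j => √(c (2 * j) ^ 2 + c (2 * j + 1) ^ 2) +
      √(b (2 * j) ^ 2 + b (2 * j + 1) ^ 2), fun j => ?_, ?_⟩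
    · have h1 : p m (j + 1) = p (m + 1) (2 * j + 1 + 1) := by rw [← hp']; ring_nf
      rw [← hp', h1]
      exact le_exp_sq_sub_one_of_concat (hl _ _) (hl _ _) (hs _ _) (hs _ _) (hb _) (hb _)
        (hsl _ _ _ (hp _ (Nat.le_succ _)) (hp _ (Nat.le_succ _)))
    · have hsplit : ∀ a : ℕ → ℝ, ∑ j ∈ Finset.range (2 ^ m),
          √(a (2 * j) ^ 2 + a (2 * j + 1) ^ 2) ^ 2 = ∑ j ∈ Finset.range (2 ^ (m + 1)), a j ^ 2 := by
        intro a
        rw [pow_succ', sum_range_two_mul]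
        exact Finset.sum_congr rfl fun j _ => Real.sq_sqrt (by positivity)
      refine (sqrt_sum_sq_add_le _ _ _).trans ?_
      rw [hsplit, hsplit, Finset.sum_range_succ']
      have e1 : ∀ i, m + 1 + i + 1 = m + (i + 1) + 1 := fun i => by ring
      have e2 : m + 1 + k = m + (k + 1) := by ring
      simp only [e1, e2] at hbs
      simp only [add_zero]
      linarith

/-- If the increments of `F` over the generations of a dyadic tree of intervals have summable `ℓ²`
norms, and the tree resolves `F`, then the higher order iterated integrals are bounded by the
sum of these norms. -/
theorem higherOrder_le_of_dyadic {F : ℝ → ℂ} (hF : LocallyIntegrable F) {x y β : ℝ}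
    {p : ℕ → ℕ → ℝ} (hp : ∀ m, Monotone (p m)) (hp' : ∀ m j, p (m + 1) (2 * j) = p m j)
    (hp0 : ∀ m, p m 0 = x) (hp1 : ∀ m, p m (2 ^ m) = y)
    (hsum : ∀ k, ∑ i ∈ Finset.range k,
      √(∑ j ∈ Finset.range (2 ^ (i + 1)),
        ‖∫ t in (p (i + 1) j)..(p (i + 1) (j + 1)), F t‖ ^ 2) ≤ β)
    (hmesh : ∀ δ > 0, ∃ k, ∀ j < 2 ^ k, ∫ t in (p k j)..(p k (j + 1)), ‖F t‖ ≤ δ) :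
    higherOrder F x y ≤ Real.exp (β ^ 2) - 1 := by
  have hxy : x ≤ y := by rw [← hp0 0, ← hp1 0]; exact hp 0 (Nat.zero_le _)
  set A := ∫ t in x..y, ‖F t‖ with hA
  have hA0 : 0 ≤ A := integral_norm_nonneg F hxy
  have key : ∀ ε > 0, higherOrder F x y ≤ Real.exp ((β + ε) ^ 2) - 1 := by
    intro ε hε
    -- leaves of mass at most `δ` contribute at most `δ * (A * exp A)` in total
    have hC : 0 < A * Real.exp A + 1 := by positivity
    obtain ⟨k, hk⟩ := hmesh (ε ^ 2 / (A * Real.exp A + 1)) (by positivity)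
    set δ := ε ^ 2 / (A * Real.exp A + 1) with hδ
    have hδ0 : 0 ≤ δ := by positivity
    have hadd : ∑ j ∈ Finset.range (2 ^ k), ∫ t in (p k j)..(p k (j + 1)), ‖F t‖ = A := by
      rw [intervalIntegral.sum_integral_adjacent_intervals
        fun j _ => hF.norm.intervalIntegrable' _ _, hp0, hp1]
    have hnn : ∀ j, 0 ≤ ∫ t in (p k j)..(p k (j + 1)), ‖F t‖ := fun j =>
      integral_norm_nonneg F (hp k (Nat.le_succ j))
    have hleaf : ∑ j ∈ Finset.range (2 ^ k), higherOrder F (p k j) (p k (j + 1)) ≤ ε ^ 2 := by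
      calc ∑ j ∈ Finset.range (2 ^ k), higherOrder F (p k j) (p k (j + 1))
          ≤ ∑ j ∈ Finset.range (2 ^ k),
              (∫ t in (p k j)..(p k (j + 1)), ‖F t‖) * (δ * Real.exp A) := by
            refine Finset.sum_le_sum fun j hj => ?_
            refine (higherOrder_le_sq_mul_exp hF (hp k (Nat.le_succ j))).trans ?_
            rw [sq, mul_assoc]
            refine mul_le_mul_of_nonneg_left ?_ (hnn j)
            refine mul_le_mul (hk j (Finset.mem_range.mp hj)) (Real.exp_le_exp.mpr ?_)
              (Real.exp_nonneg _) hδ0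
            rw [← hadd]
            exact Finset.single_le_sum (f := fun j => ∫ t in (p k j)..(p k (j + 1)), ‖F t‖)
              (fun i _ => hnn i) hj
        _ = δ * (A * Real.exp A) := by rw [← Finset.sum_mul, hadd]; ring
        _ ≤ δ * (A * Real.exp A + 1) := by nlinarith
        _ = ε ^ 2 := div_mul_cancel₀ _ hC.ne'
    obtain ⟨b, hb, hbs⟩ := exists_dyadic_bound (s := higherOrder F)
      (l := fun x y => ‖∫ t in x..y, F t‖) (higherOrder_nonneg F) (fun _ _ => norm_nonneg _)
      (fun _ _ _ => higherOrder_le hF) hp hp' k 0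
    have hb0 := hb 0
    have e1 : p 0 (0 + 1) = y := hp1 0
    rw [hp0, e1] at hb0
    refine hb0.trans ?_
    simp only [zero_add, pow_zero, Finset.sum_range_one] at hbs
    have hb' : |b 0| ≤ β + ε := by
      rw [← Real.sqrt_sq_eq_abs]
      refine hbs.trans (add_le_add (hsum k) ?_)
      exact Real.sqrt_le_iff.mpr ⟨hε.le, hleaf⟩
    have : b 0 ^ 2 ≤ (β + ε) ^ 2 := by
      rw [← sq_abs]; exact pow_le_pow_left₀ (abs_nonneg _) hb' 2
    linarith [Real.exp_le_exp.mpr this]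
  have hlim : Tendsto (fun ε : ℝ => Real.exp ((β + ε) ^ 2) - 1) (𝓝[>] 0)
      (𝓝 (Real.exp (β ^ 2) - 1)) := by
    have : Continuous fun ε : ℝ => Real.exp ((β + ε) ^ 2) - 1 := by fun_prop
    have h := this.tendsto 0
    simp only [add_zero] at h
    exact h.mono_left nhdsWithin_le_nhds
  exact ge_of_tendsto hlim (eventually_mem_nhdsWithin.mono key)

/-! ### Martingale structures -/

namespace MartingaleStructure

variable (𝓔 : MartingaleStructure)

/-- The union of the intervals of generation `m` to the left of the `j`-th one. -/
def initial (m j : ℕ) : Set ℝ := {t | ∃ i, i < j ∧ i < 2 ^ m ∧ t ∈ 𝓔.I m i}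

theorem nonneg_of_mem {m i : ℕ} (hi : i < 2 ^ m) {t : ℝ} (ht : t ∈ 𝓔.I m i) : 0 ≤ t := by
  have : t ∈ ⋃ j ∈ Finset.range (2 ^ m), 𝓔.I m j :=
    Set.mem_biUnion (Finset.mem_coe.mpr (Finset.mem_range.mpr hi)) ht
  rwa [𝓔.cover] at this

theorem exists_mem (m : ℕ) {t : ℝ} (ht : 0 ≤ t) : ∃ i < 2 ^ m, t ∈ 𝓔.I m i := by
  have : t ∈ ⋃ j ∈ Finset.range (2 ^ m), 𝓔.I m j := by rw [𝓔.cover]; exact ht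
  simpa using this

theorem measurableSet_I {m i : ℕ} (hi : i < 2 ^ m) : MeasurableSet (𝓔.I m i) :=
  (𝓔.interval m i hi).measurableSet

theorem initial_mono (m : ℕ) : Monotone (𝓔.initial m) :=
  fun _ _ h _ ⟨i, hi, hi', ht⟩ => ⟨i, hi.trans_le h, hi', ht⟩

theorem initial_zero (m : ℕ) : 𝓔.initial m 0 = ∅ := by
  ext t; simp [initial]

theorem initial_two_pow (m : ℕ) : 𝓔.initial m (2 ^ m) = Set.Ici 0 := by
  ext t
  constructor
  · rintro ⟨i, hi, _, ht⟩
    exact 𝓔.nonneg_of_mem hi ht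
  · intro ht
    obtain ⟨i, hi, hi'⟩ := 𝓔.exists_mem m ht
    exact ⟨i, hi, hi, hi'⟩

theorem initial_two_mul (m j : ℕ) : 𝓔.initial (m + 1) (2 * j) = 𝓔.initial m j := by
  ext t
  constructor
  · rintro ⟨i, hi, hi', ht⟩
    rw [pow_succ] at hi'
    have h2 : i / 2 < 2 ^ m := by omega
    refine ⟨i / 2, by omega, h2, ?_⟩
    rw [𝓔.split m _ h2]
    rcases Nat.even_or_odd' i with ⟨c, hc | hc⟩
    · left; rwa [show 2 * (i / 2) = i by omega]
    · right; rwa [show 2 * (i / 2) + 1 = i by omega]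
  · rintro ⟨i, hi, hi', ht⟩
    rw [𝓔.split m _ hi'] at ht
    rcases ht with ht | ht
    · exact ⟨2 * i, by omega, by rw [pow_succ]; omega, ht⟩
    · exact ⟨2 * i + 1, by omega, by rw [pow_succ]; omega, ht⟩

theorem mem_initial_of_le {m j : ℕ} {s t : ℝ} (ht : t ∈ 𝓔.initial m j) (hs : 0 ≤ s)
    (hst : s ≤ t) : s ∈ 𝓔.initial m j := by
  obtain ⟨i, hi, hi', hti⟩ := ht
  obtain ⟨k, hk, hsk⟩ := 𝓔.exists_mem m hs
  refine ⟨k, ?_, hk, hsk⟩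
  by_contra! h
  exact absurd (𝓔.ordered m i k (hi.trans_le h) hk t hti s hsk) (not_lt.mpr hst)

theorem initial_succ {m j : ℕ} (hj : j < 2 ^ m) :
    𝓔.initial m (j + 1) = 𝓔.initial m j ∪ 𝓔.I m j := by
  ext t
  constructor
  · rintro ⟨i, hi, hi', ht⟩
    rcases Nat.lt_succ_iff_lt_or_eq.mp hi with h | rfl
    · exact Or.inl ⟨i, h, hi', ht⟩
    · exact Or.inr ht
  · rintro (⟨i, hi, hi', ht⟩ | ht)
    · exact ⟨i, hi.trans (Nat.lt_succ_self j), hi', ht⟩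
    · exact ⟨j, Nat.lt_succ_self j, hj, ht⟩

theorem disjoint_initial {m j : ℕ} (hj : j < 2 ^ m) : Disjoint (𝓔.initial m j) (𝓔.I m j) := by
  rw [Set.disjoint_left]
  rintro t ⟨i, hi, hi', ht⟩ ht'
  exact Set.disjoint_left.mp (𝓔.disjoint m i j hi' hj hi.ne) ht ht'

/-- Every interval of generation `m + d` lies in one of generation `m`. -/
theorem exists_subset (m d : ℕ) {j : ℕ} (hj : j < 2 ^ (m + d)) :
    ∃ i < 2 ^ m, 𝓔.I (m + d) j ⊆ 𝓔.I m i := by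
  induction d generalizing j with
  | zero => exact ⟨j, hj, subset_rfl⟩
  | succ d ih =>
    have hj' : j < 2 ^ (m + d) * 2 := by rwa [← pow_succ]
    have h2 : j / 2 < 2 ^ (m + d) := by omega
    obtain ⟨i, hi, hsub⟩ := ih h2
    refine ⟨i, hi, Set.Subset.trans ?_ hsub⟩
    rw [𝓔.split (m + d) _ h2]
    rcases Nat.even_or_odd' j with ⟨c, hc | hc⟩
    · rw [show 2 * (j / 2) = j by omega]; exact Set.subset_union_left
    · rw [show 2 * (j / 2) + 1 = j by omega]; exact Set.subset_union_right

/-- The `j`-th division point of the partition of `[x, y]` into the traces of the intervals of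
generation `m`. -/
noncomputable def cut (x y : ℝ) (m j : ℕ) : ℝ := sSup (insert x (𝓔.initial m j ∩ Set.Icc x y))

variable {x y : ℝ}

theorem bddAbove_cut (hxy : x ≤ y) (m j : ℕ) :
    BddAbove (insert x (𝓔.initial m j ∩ Set.Icc x y)) :=
  ⟨y, by rintro t (rfl | ht); exacts [hxy, ht.2.2]⟩

theorem le_cut (hxy : x ≤ y) (m j : ℕ) : x ≤ 𝓔.cut x y m j :=
  le_csSup (𝓔.bddAbove_cut hxy m j) (Set.mem_insert _ _)

theorem cut_le (hxy : x ≤ y) (m j : ℕ) : 𝓔.cut x y m j ≤ y :=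
  csSup_le (Set.insert_nonempty _ _) (by rintro t (rfl | ht); exacts [hxy, ht.2.2])

theorem cut_mono (hxy : x ≤ y) (m : ℕ) : Monotone (𝓔.cut x y m) := fun _ j h =>
  csSup_le_csSup (𝓔.bddAbove_cut hxy m j) (Set.insert_nonempty _ _)
    (Set.insert_subset_insert (Set.inter_subset_inter_left _ (𝓔.initial_mono m h)))

theorem cut_two_mul (m j : ℕ) : 𝓔.cut x y (m + 1) (2 * j) = 𝓔.cut x y m j := by
  rw [cut, cut, initial_two_mul]

theorem cut_zero (m : ℕ) : 𝓔.cut x y m 0 = x := by simp [cut, initial_zero]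

theorem cut_two_pow (hx : 0 ≤ x) (hxy : x ≤ y) (m : ℕ) : 𝓔.cut x y m (2 ^ m) = y := by
  refine le_antisymm (𝓔.cut_le hxy _ _)
    (le_csSup (𝓔.bddAbove_cut hxy m _) (Or.inr ⟨?_, hxy, le_rfl⟩))
  rw [initial_two_pow]
  exact hx.trans hxy

theorem le_cut_of_mem (hxy : x ≤ y) {m j : ℕ} {t : ℝ} (ht : t ∈ 𝓔.initial m j)
    (ht' : t ∈ Set.Icc x y) : t ≤ 𝓔.cut x y m j :=
  le_csSup (𝓔.bddAbove_cut hxy m j) (Or.inr ⟨ht, ht'⟩)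

theorem mem_initial_of_lt_cut (hx : 0 ≤ x) {m j : ℕ} {t : ℝ} (hxt : x ≤ t)
    (ht : t < 𝓔.cut x y m j) : t ∈ 𝓔.initial m j := by
  obtain ⟨s, hs, hts⟩ := exists_lt_of_lt_csSup (Set.insert_nonempty _ _) ht
  rcases hs with rfl | hs
  · exact absurd hxt (not_le.mpr hts)
  · exact 𝓔.mem_initial_of_le hs.1 (hx.trans hxt) hts.le

theorem setIntegral_initial (hx : 0 ≤ x) (hxy : x ≤ y) (F : ℝ → ℂ) (m j : ℕ) :
    ∫ t in 𝓔.initial m j ∩ Set.Ico x y, F t = ∫ t in x..(𝓔.cut x y m j), F t := by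
  rw [intervalIntegral.integral_of_le (𝓔.le_cut hxy m j)]
  refine setIntegral_congr_set (Filter.EventuallyLE.antisymm ?_ ?_)
  · refine EventuallyLE.trans (LE.le.eventuallyLE ?_) Ioc_ae_eq_Icc.symm.le
    exact fun t ht => ⟨ht.2.1, 𝓔.le_cut_of_mem hxy ht.1 (Set.Ico_subset_Icc_self ht.2)⟩
  · refine EventuallyLE.trans Ioo_ae_eq_Ioc.symm.le (LE.le.eventuallyLE ?_)
    exact fun t ht => ⟨𝓔.mem_initial_of_lt_cut hx ht.1.le ht.2, ht.1.le,
      ht.2.trans_le (𝓔.cut_le hxy m j)⟩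

theorem integral_cut (hx : 0 ≤ x) (hxy : x ≤ y) {F : ℝ → ℂ} (hF : LocallyIntegrable F)
    {m j : ℕ} (hj : j < 2 ^ m) :
    ∫ t in (𝓔.cut x y m j)..(𝓔.cut x y m (j + 1)), F t = ∫ t in 𝓔.I m j ∩ Set.Ico x y, F t := by
  have hint : IntegrableOn F (Set.Ico x y) :=
    (hF.integrableOn_isCompact isCompact_Icc).mono_set Set.Ico_subset_Icc_self
  have h := 𝓔.setIntegral_initial hx hxy F m (j + 1)
  rw [𝓔.initial_succ hj, Set.union_inter_distrib_right, setIntegral_union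
    ((𝓔.disjoint_initial hj).mono Set.inter_subset_left Set.inter_subset_left)
    ((𝓔.measurableSet_I hj).inter measurableSet_Ico) (hint.mono_set Set.inter_subset_right)
    (hint.mono_set Set.inter_subset_right), 𝓔.setIntegral_initial hx hxy,
    ← intervalIntegral.integral_add_adjacent_intervals
      (hF.intervalIntegrable' x (𝓔.cut x y m j))
      (hF.intervalIntegrable' (𝓔.cut x y m j) (𝓔.cut x y m (j + 1)))] at h
  exact (add_left_cancel h).symm

end MartingaleStructure

section

variable (𝓔 : MartingaleStructure) {F : ℝ → ℂ}

theorem hasImproperIntegral_improperIntegral {s : ℝ} {f : ℝ → ℂ} (hf : bSeminorm 𝓔 s f ≠ ⊤)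
    {m j : ℕ} (hj : j < 2 ^ m) :
    HasImproperIntegral f (𝓔.I m j) (improperIntegral f (𝓔.I m j)) := by
  unfold bSeminorm at hf
  split_ifs at hf with h
  · obtain ⟨a, ha⟩ := h m j hj
    exact tendsto_nhds_limUnder ⟨a, ha⟩
  · exact absurd rfl hf

theorem sum_levels_le {f : ℝ → ℂ} (hf : bSeminorm 𝓔 1 f ≠ ⊤) (k : ℕ) :
    ∑ i ∈ Finset.range k,
      √(∑ j ∈ Finset.range (2 ^ (i + 1)), ‖improperIntegral f (𝓔.I (i + 1) j)‖ ^ 2) ≤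
    (bSeminorm 𝓔 1 f).toReal := by
  rw [← ENNReal.ofReal_le_iff_le_toReal hf, ENNReal.ofReal_sum_of_nonneg
    fun _ _ => Real.sqrt_nonneg _]
  unfold bSeminorm at hf ⊢
  split_ifs at hf ⊢ with h
  · set g : ℕ → ℝ≥0∞ := fun m => (m : ℝ≥0∞) ^ (1 : ℝ) *
      ENNReal.ofReal (√(∑ j ∈ Finset.range (2 ^ m), ‖improperIntegral f (𝓔.I m j)‖ ^ 2))
    calc _ ≤ ∑ i ∈ Finset.range k, g (i + 1) := by
          -- the weights are at least one and can be dropped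
          refine Finset.sum_le_sum fun i _ => ?_
          refine le_mul_of_one_le_left (zero_le) ?_
          rw [ENNReal.rpow_one]
          exact_mod_cast Nat.succ_le_succ (Nat.zero_le i)
      _ ≤ ∑ i ∈ Finset.range (k + 1), g i := by
          rw [Finset.sum_range_succ' g]; exact le_self_add
      _ ≤ _ := ENNReal.sum_le_tsum _
  · exact absurd rfl hf

/-- The integral over a bounded part is the difference of the improper integrals of two tails. -/
theorem setIntegral_inter_Ico (hF : LocallyIntegrable F) {x y : ℝ} (hxy : x ≤ y)
    {S : Set ℝ} (hS0 : S ⊆ Set.Ici 0) {a b : ℂ}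
    (ha : HasImproperIntegral ((Set.Ici x).indicator F) S a)
    (hb : HasImproperIntegral ((Set.Ici y).indicator F) S b) :
    ∫ t in S ∩ Set.Ico x y, F t = a - b := by
  refine tendsto_nhds_unique (tendsto_const_nhds.congr' ?_) (Tendsto.sub ha hb)
  filter_upwards [eventually_ge_atTop y] with N hN
  have hint : ∀ z, IntegrableOn ((Set.Ici z).indicator F) (S ∩ Set.Iic N) := fun z =>
    ((hF.integrableOn_isCompact (isCompact_Icc (a := 0) (b := N))).mono_set
      fun t ht => ⟨hS0 ht.1, ht.2⟩).indicator measurableSet_Ici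
  rw [← integral_sub (hint x) (hint y)]
  have hfun : ∀ t, (Set.Ici x).indicator F t - (Set.Ici y).indicator F t =
      (Set.Ico x y).indicator F t := by
    intro t
    simp only [Set.indicator, Set.mem_Ici, Set.mem_Ico]
    by_cases h1 : x ≤ t <;> by_cases h2 : y ≤ t <;> simp [h1, h2]
    · exact absurd (hxy.trans h2) h1
  simp only [hfun]
  rw [setIntegral_indicator measurableSet_Ico]
  congr 2
  ext t
  simp only [Set.mem_inter_iff, Set.mem_Ico, Set.mem_Iic]
  constructor
  · exact fun h => ⟨⟨h.1, h.2.2.le.trans hN⟩, h.2⟩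
  · exact fun h => ⟨h.1.1, h.2⟩

/-- The increments of `F` over the traces of the structure on `[x, y)` are controlled by the
seminorms of the two tails starting at `x` and at `y`. -/
theorem sum_increments_le (hF : LocallyIntegrable F) {x y : ℝ} (hxy : x ≤ y)
    (hfx : bSeminorm 𝓔 1 ((Set.Ici x).indicator F) ≠ ⊤)
    (hfy : bSeminorm 𝓔 1 ((Set.Ici y).indicator F) ≠ ⊤) (k : ℕ) :
    ∑ i ∈ Finset.range k,
      √(∑ j ∈ Finset.range (2 ^ (i + 1)), ‖∫ t in 𝓔.I (i + 1) j ∩ Set.Ico x y, F t‖ ^ 2) ≤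
    (bSeminorm 𝓔 1 ((Set.Ici x).indicator F)).toReal +
      (bSeminorm 𝓔 1 ((Set.Ici y).indicator F)).toReal := by
  refine le_trans ?_ (add_le_add (sum_levels_le 𝓔 hfx k) (sum_levels_le 𝓔 hfy k))
  rw [← Finset.sum_add_distrib]
  refine Finset.sum_le_sum fun i _ => le_trans ?_ (sqrt_sum_sq_add_le _ _ _)
  refine Real.sqrt_le_sqrt (Finset.sum_le_sum fun j hj => ?_)
  have hj' := Finset.mem_range.mp hj
  rw [setIntegral_inter_Ico hF hxy (fun t => 𝓔.nonneg_of_mem hj')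
    (hasImproperIntegral_improperIntegral 𝓔 hfx hj')
    (hasImproperIntegral_improperIntegral 𝓔 hfy hj')]
  exact pow_le_pow_left₀ (norm_nonneg _) (norm_sub_le _ _) 2

/-- The integral over an interval that is divided in no generation vanishes, since it contributes
the same amount to every generation. -/
theorem integral_eq_zero_of_undivided (hF : LocallyIntegrable F) {x y : ℝ}
    (hxy : x ≤ y) (hfx : bSeminorm 𝓔 1 ((Set.Ici x).indicator F) ≠ ⊤)
    (hfy : bSeminorm 𝓔 1 ((Set.Ici y).indicator F) ≠ ⊤)
    (h : ∀ m, ∃ i < 2 ^ m, Set.Ico x y ⊆ 𝓔.I m i) : ∫ t in x..y, F t = 0 := by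
  rw [intervalIntegral.integral_of_le hxy, ← integral_Ico_eq_integral_Ioc]
  set C := (bSeminorm 𝓔 1 ((Set.Ici x).indicator F)).toReal +
      (bSeminorm 𝓔 1 ((Set.Ici y).indicator F)).toReal
  by_contra hne
  obtain ⟨k, hk⟩ := exists_nat_gt (C / ‖∫ t in Set.Ico x y, F t‖)
  rw [div_lt_iff₀ (norm_pos_iff.mpr hne)] at hk
  refine absurd (sum_increments_le 𝓔 hF hxy hfx hfy k) (not_le.mpr (hk.trans_le ?_))
  rw [← nsmul_eq_mul, ← Finset.card_range k, ← Finset.sum_const, Finset.card_range]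
  refine Finset.sum_le_sum fun m _ => Real.le_sqrt_of_sq_le ?_
  obtain ⟨i, hi, hsub⟩ := h (m + 1)
  refine le_trans (le_of_eq ?_) (Finset.single_le_sum
    (f := fun j => ‖∫ t in 𝓔.I (m + 1) j ∩ Set.Ico x y, F t‖ ^ 2)
    (fun _ _ => by positivity) (Finset.mem_range.mpr hi))
  simp only [Set.inter_eq_self_of_subset_right hsub]

end

theorem ae_eq_zero_of_integral_eq_zero {F : ℝ → ℂ} (hF : LocallyIntegrable F) {a b : ℝ}
    (h : ∀ s t, a < s → s ≤ t → t < b → ∫ u in s..t, F u = 0) :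
    ∀ᵐ t, t ∈ Set.Ioo a b → F t = 0 := by
  filter_upwards [_root_.LocallyIntegrable.ae_hasDerivAt_integral hF] with t ht htab
  refine (ht t).unique ?_
  refine (hasDerivAt_const t (0 : ℂ)).congr_of_eventuallyEq ?_
  filter_upwards [Ioo_mem_nhds htab.1 htab.2] with u hu
  rcases le_total t u with htu | hut
  · exact h t u htab.1 htu hu.2
  · rw [intervalIntegral.integral_symm, h u t hu.1 hut htab.2, neg_zero]

/-- The structure resolves `F` where all tails have finite seminorm: in the limit the intervals
of the structure shrink to intervals on which `F` vanishes. -/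
theorem exists_mesh_le (𝓔 : MartingaleStructure) {F : ℝ → ℂ} (hF : LocallyIntegrable F) {x y : ℝ}
    (hx : 0 ≤ x) (hxy : x ≤ y) (hfin : ∀ z ≥ x, bSeminorm 𝓔 1 ((Set.Ici z).indicator F) ≠ ⊤)
    {δ : ℝ} (hδ : 0 < δ) :
    ∃ k, ∀ j < 2 ^ k, ∫ t in (𝓔.cut x y k j)..(𝓔.cut x y k (j + 1)), ‖F t‖ ≤ δ := by
  by_contra! hcon
  choose j hj hjδ using hcon
  -- a limit `[a, b]` of intervals of increasing generations on which `‖F‖` has mass at least `δ`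
  obtain ⟨⟨a, b⟩, hab, φ, hφ, hlim⟩ := (isCompact_Icc.prod isCompact_Icc).tendsto_subseq
    (s := Set.Icc x y ×ˢ Set.Icc x y)
    (x := fun k => (𝓔.cut x y k (j k), 𝓔.cut x y k (j k + 1)))
    (fun k => ⟨⟨𝓔.le_cut hxy _ _, 𝓔.cut_le hxy _ _⟩, ⟨𝓔.le_cut hxy _ _, 𝓔.cut_le hxy _ _⟩⟩)
  have hlima : Tendsto (fun n => 𝓔.cut x y (φ n) (j (φ n))) atTop (𝓝 a) :=
    (continuous_fst.tendsto _).comp hlim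
  have hlimb : Tendsto (fun n => 𝓔.cut x y (φ n) (j (φ n) + 1)) atTop (𝓝 b) :=
    (continuous_snd.tendsto _).comp hlim
  have hax : x ≤ a := hab.1.1
  have hby : b ≤ y := hab.2.2
  have hN := intervalIntegral.continuous_primitive (μ := volume) hF.norm.intervalIntegrable' 0
  have hsub : ∀ s t, ∫ u in s..t, ‖F u‖ = (∫ u in 0..t, ‖F u‖) - ∫ u in 0..s, ‖F u‖ := fun s t =>
    (intervalIntegral.integral_interval_sub_left (hF.norm.intervalIntegrable' _ _)
      (hF.norm.intervalIntegrable' _ _)).symm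
  have hδab : δ ≤ ∫ u in a..b, ‖F u‖ := by
    rw [hsub]
    refine ge_of_tendsto (((hN.tendsto b).comp hlimb).sub ((hN.tendsto a).comp hlima))
      (Eventually.of_forall fun n => ?_)
    have := hjδ (φ n)
    rw [hsub] at this
    exact this.le
  have hle : a ≤ b := le_of_tendsto_of_tendsto' hlima hlimb
    fun n => 𝓔.cut_mono hxy _ (Nat.le_succ _)
  -- no interval inside `(a, b)` is divided in any generation
  have hzero : ∀ s t, a < s → s ≤ t → t < b → ∫ u in s..t, F u = 0 := by
    intro s t has hst htb
    have hxs : x ≤ s := hax.trans has.le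
    refine integral_eq_zero_of_undivided 𝓔 hF hst (hfin s hxs)
      (hfin t (hxs.trans hst)) fun m => ?_
    obtain ⟨n, hn1, hn2, hn3⟩ := ((hlima.eventually_lt_const has).and
      ((hlimb.eventually_const_lt htb).and (eventually_ge_atTop m))).exists
    obtain ⟨d, hd⟩ := Nat.exists_eq_add_of_le (hn3.trans (hφ.id_le n))
    have hjn := hj (φ n)
    have hIco : Set.Ico s t ⊆ 𝓔.I (φ n) (j (φ n)) := by
      intro u hu
      have hxu : x ≤ u := hxs.trans hu.1
      have h1 := 𝓔.mem_initial_of_lt_cut hx hxu (hu.2.trans hn2)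
      rw [𝓔.initial_succ hjn] at h1
      refine h1.resolve_left fun h2 => ?_
      have := 𝓔.le_cut_of_mem hxy h2 ⟨hxu, (hu.2.trans htb).le.trans hby⟩
      exact absurd (hn1.trans_le hu.1) (not_lt.mpr this)
    rw [hd] at hIco hjn
    obtain ⟨i, hi, hi'⟩ := 𝓔.exists_subset m d hjn
    exact ⟨i, hi, hIco.trans hi'⟩
  have hae := ae_eq_zero_of_integral_eq_zero hF hzero
  have : ∫ u in a..b, ‖F u‖ = 0 := by
    rw [intervalIntegral.integral_of_le hle, integral_Ioc_eq_integral_Ioo]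
    refine setIntegral_eq_zero_of_ae_eq_zero ?_
    filter_upwards [hae] with t ht htab
    rw [ht htab, norm_zero]
  linarith

/-- The iterated integrals over an interval on which the tails of `F` have finite seminorm are
controlled by the seminorms of the tails at the endpoints. -/
theorem tsum_norm_iter_le (𝓔 : MartingaleStructure) {F : ℝ → ℂ} (hF : LocallyIntegrable F)
    {x y : ℝ} (hx : 0 ≤ x) (hxy : x ≤ y)
    (hfin : ∀ z ≥ x, bSeminorm 𝓔 1 ((Set.Ici z).indicator F) ≠ ⊤) {β : ℝ}
    (hβ : (bSeminorm 𝓔 1 ((Set.Ici x).indicator F)).toReal +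
      (bSeminorm 𝓔 1 ((Set.Ici y).indicator F)).toReal ≤ β) :
    ∑' n, ‖iter F n x y‖ ≤ 2 * β + Real.exp (β ^ 2) := by
  have hsum : ∀ k, ∑ i ∈ Finset.range k, √(∑ j ∈ Finset.range (2 ^ (i + 1)),
      ‖∫ t in (𝓔.cut x y (i + 1) j)..(𝓔.cut x y (i + 1) (j + 1)), F t‖ ^ 2) ≤ β := by
    intro k
    refine le_trans (le_of_eq ?_)
      ((sum_increments_le 𝓔 hF hxy (hfin x le_rfl) (hfin y hxy) k).trans hβ)
    refine Finset.sum_congr rfl fun i _ => ?_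
    congr 1
    refine Finset.sum_congr rfl fun j hj => ?_
    rw [𝓔.integral_cut hx hxy hF (Finset.mem_range.mp hj)]
  have h1 := higherOrder_le_of_dyadic hF (𝓔.cut_mono hxy) 𝓔.cut_two_mul 𝓔.cut_zero
    (𝓔.cut_two_pow hx hxy) hsum fun δ hδ => exists_mesh_le 𝓔 hF hx hxy hfin hδ
  have h2 : ‖∫ t in x..y, F t‖ ≤ 2 * β := by
    have h3 := hsum 1
    have e2 : 𝓔.cut x y 1 2 = y := 𝓔.cut_two_pow hx hxy 1
    simp only [zero_add, pow_one, Finset.sum_range_succ, Finset.sum_range_zero,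
      𝓔.cut_zero] at h3
    rw [show 1 + 1 = 2 from rfl, e2] at h3
    rw [← intervalIntegral.integral_add_adjacent_intervals
      (hF.intervalIntegrable' x (𝓔.cut x y 1 1)) (hF.intervalIntegrable' _ y), two_mul]
    refine (norm_add_le _ _).trans (add_le_add (le_trans ?_ h3) (le_trans ?_ h3))
    · exact Real.le_sqrt_of_sq_le (le_add_of_nonneg_right (by positivity))
    · exact Real.le_sqrt_of_sq_le (le_add_of_nonneg_left (by positivity))
  rw [tsum_norm_iter_eq hF hxy]
  linarith

/-! ### The limit of the iterated integrals at infinity -/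

/-- The iterated integrals of `F` are small far out: in total, the ones of positive order over an
interval `[x, y]` tend to zero as `x → ∞`, uniformly in `y`. -/
def SmallAtInfinity (F : ℝ → ℂ) : Prop :=
  ∀ ε > 0, ∃ M : ℝ, 0 ≤ M ∧ ∀ x y, M ≤ x → x ≤ y → ∑' n, ‖iter F n x y‖ ≤ 1 + ε

/-- The value at `y = ∞` of the iterated integrals from `x` to `y`. -/
noncomputable def iterLim (F : ℝ → ℂ) (n : ℕ) (x : ℝ) : ℂ := limUnder atTop fun y => iter F n x y

section

variable {F : ℝ → ℂ} (hF : LocallyIntegrable F) (hS : SmallAtInfinity F)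
include hF

theorem integral_norm_mono {a b c d : ℝ} (hac : c ≤ a) (hab : a ≤ b) (hbd : b ≤ d) :
    ∫ t in a..b, ‖F t‖ ≤ ∫ t in c..d, ‖F t‖ :=
  intervalIntegral.integral_mono_interval hac hab hbd
    (Eventually.of_forall fun _ => norm_nonneg _) (hF.norm.intervalIntegrable' _ _)

theorem norm_iter_le_tsum {x y : ℝ} (hxy : x ≤ y) (n : ℕ) :
    ‖iter F n x y‖ ≤ ∑' n, ‖iter F n x y‖ :=
  (summable_norm_iter hF hxy).le_tsum n fun _ _ => norm_nonneg _

theorem norm_iter_succ_le_tsum_sub_one {x y : ℝ} (hxy : x ≤ y) (n : ℕ) :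
    ‖iter F (n + 1) x y‖ ≤ ∑' n, ‖iter F n x y‖ - 1 := by
  have h := (summable_norm_iter hF hxy).tsum_eq_zero_add
  rw [iter_zero, norm_one] at h
  have h2 := ((summable_nat_add_iff 1).mpr (summable_norm_iter hF hxy)).le_tsum n
    fun _ _ => norm_nonneg _
  linarith

include hS

/-- Uniform boundedness of the iterated integrals over all intervals to the right of `x`. -/
theorem exists_tsum_norm_iter_le (x : ℝ) :
    ∃ K : ℝ, 0 ≤ K ∧ ∀ t y, x ≤ t → t ≤ y → ∑' n, ‖iter F n t y‖ ≤ K := by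
  obtain ⟨M, -, hM⟩ := hS 1 one_pos
  set M' := max M x
  have hMM' : M ≤ M' := le_max_left _ _
  have hxM' : x ≤ M' := le_max_right _ _
  set e := Real.exp (∫ t in x..M', ‖F t‖)
  have he : 1 ≤ e := Real.one_le_exp (integral_norm_nonneg F hxM')
  have hle : ∀ s t, x ≤ s → s ≤ t → t ≤ M' → ∑' n, ‖iter F n s t‖ ≤ e := fun s t h1 h2 h3 =>
    (tsum_norm_iter_le_exp hF h2).trans (Real.exp_le_exp.mpr (integral_norm_mono hF h1 h2 h3))
  refine ⟨e * (1 + 1), by positivity, fun t y hxt hty => ?_⟩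
  rcases le_total y M' with hy | hy
  · linarith [hle t y hxt hty hy]
  · rcases le_total t M' with ht | ht
    · exact (tsum_norm_iter_le_mul hF ht hy).trans
        (mul_le_mul (hle t M' hxt ht le_rfl) (hM M' y hMM' hy)
          (tsum_nonneg fun _ => norm_nonneg _) (by positivity))
    · linarith [hM t y (hMM'.trans ht) hty]

theorem tendsto_iterLim (n : ℕ) (x : ℝ) :
    Tendsto (fun y => iter F n x y) atTop (𝓝 (iterLim F n x)) := by
  refine tendsto_nhds_limUnder (cauchySeq_tendsto_of_complete ?_)
  cases n with
  | zero => simpa only [iter_zero] using cauchySeq_const (1 : ℂ)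
  | succ n =>
    obtain ⟨K, hK0, hK⟩ := exists_tsum_norm_iter_le hF hS x
    rw [Metric.cauchySeq_iff']
    intro ε hε
    -- each of the `n + 1` terms involving the far interval is at most `K * η`
    set η := ε / ((n + 1) * K + 1) with hη
    have hη0 : 0 < η := by positivity
    obtain ⟨M, -, hM⟩ := hS η hη0
    refine ⟨max M x, fun y hy => ?_⟩
    have hMy : M ≤ max M x := le_max_left _ _
    have hxM : x ≤ max M x := le_max_right _ _
    rw [dist_eq_norm, iter_eq_sum_antidiagonal hF (n + 1) x (max M x) y,
      Finset.Nat.sum_antidiagonal_succ']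
    simp only [twist_zero, iter_zero, mul_one, add_sub_cancel_left]
    calc _ ≤ ∑ p ∈ Finset.HasAntidiagonal.antidiagonal n, K * η := by
          refine (norm_sum_le _ _).trans (Finset.sum_le_sum fun p _ => ?_)
          rw [norm_mul, norm_twist]
          refine mul_le_mul ((norm_iter_le_tsum hF hxM _).trans (hK _ _ le_rfl hxM)) ?_
            (norm_nonneg _) hK0
          have := norm_iter_succ_le_tsum_sub_one hF hy p.2
          linarith [hM _ y hMy hy]
      _ = (n + 1) * K * η := by simp; ring
      _ < ((n + 1) * K + 1) * η := by linarith
      _ = ε := mul_div_cancel₀ _ (by positivity)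

omit hF hS in
theorem iterLim_zero (x : ℝ) : iterLim F 0 x = 1 :=
  Tendsto.limUnder_eq (by simpa only [iter_zero] using tendsto_const_nhds)

theorem sum_norm_iterLim_le {x K : ℝ} (hK : ∀ᶠ y in atTop, ∑' n, ‖iter F n x y‖ ≤ K) (N : ℕ) :
    ∑ n ∈ Finset.range N, ‖iterLim F n x‖ ≤ K := by
  refine le_of_tendsto (tendsto_finsetSum _ fun n _ => (tendsto_iterLim hF hS n x).norm) ?_
  filter_upwards [hK, eventually_ge_atTop x] with y hy hxy
  exact ((summable_norm_iter hF hxy).sum_le_tsum _ fun _ _ => norm_nonneg _).trans hy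

theorem summable_norm_iterLim (x : ℝ) : Summable fun n => ‖iterLim F n x‖ := by
  obtain ⟨K, -, hK⟩ := exists_tsum_norm_iter_le hF hS x
  exact summable_of_sum_range_le (fun _ => norm_nonneg _) (sum_norm_iterLim_le hF hS
    ((eventually_ge_atTop x).mono fun y hy => hK x y le_rfl hy))

theorem tsum_norm_iterLim_le {x K : ℝ} (hK : ∀ᶠ y in atTop, ∑' n, ‖iter F n x y‖ ≤ K) :
    ∑' n, ‖iterLim F n x‖ ≤ K :=
  (summable_norm_iterLim hF hS x).tsum_le_of_sum_range_le (sum_norm_iterLim_le hF hS hK)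

theorem exists_tsum_norm_iterLim_le (x : ℝ) :
    ∃ K : ℝ, ∀ t, x ≤ t → ∑' n, ‖iterLim F n t‖ ≤ K := by
  obtain ⟨K, -, hK⟩ := exists_tsum_norm_iter_le hF hS x
  exact ⟨K, fun t ht => tsum_norm_iterLim_le hF hS
    ((eventually_ge_atTop t).mono fun y hy => hK t y ht hy)⟩

theorem aestronglyMeasurable_iterLim (n : ℕ) (μ : Measure ℝ) :
    AEStronglyMeasurable (iterLim F n) μ :=
  aestronglyMeasurable_of_tendsto_ae atTop
    (fun y => (continuous_iter hF n y).aestronglyMeasurable)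
    (Eventually.of_forall fun x => tendsto_iterLim hF hS n x)

theorem integral_twist_mul_iterLim (n : ℕ) {x y : ℝ} (hxy : x ≤ y) :
    ∫ t in x..y, twist (n + 1) (F t) * iterLim F n t =
      iterLim F (n + 1) x - iterLim F (n + 1) y := by
  obtain ⟨K, hK0, hK⟩ := exists_tsum_norm_iter_le hF hS x
  have h1 : Tendsto (fun z => ∫ t in x..y, twist (n + 1) (F t) * iter F n t z) atTop
      (𝓝 (∫ t in x..y, twist (n + 1) (F t) * iterLim F n t)) := by
    refine intervalIntegral.tendsto_integral_filter_of_dominated_convergence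
      (fun t => ‖F t‖ * K) ?_ ?_ ((hF.norm.intervalIntegrable' x y).mul_const K) ?_
    · exact Eventually.of_forall fun z =>
        (intervalIntegrable_iff.mp
          (intervalIntegrable_twist_mul_iter hF _ _ z x y)).aestronglyMeasurable
    · filter_upwards [eventually_ge_atTop y] with z hz
      refine Eventually.of_forall fun t ht => ?_
      rw [Set.uIoc_of_le hxy] at ht
      rw [norm_mul, norm_twist]
      exact mul_le_mul_of_nonneg_left ((norm_iter_le_tsum hF (ht.2.trans hz) n).trans
        (hK t z ht.1.le (ht.2.trans hz))) (norm_nonneg _)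
    · exact Eventually.of_forall fun t _ => (tendsto_iterLim hF hS n t).const_mul _
  refine tendsto_nhds_unique h1 (((tendsto_iterLim hF hS (n + 1) x).sub
    (tendsto_iterLim hF hS (n + 1) y)).congr fun z => ?_)
  rw [iter_succ_eq_add hF n x y z, add_sub_cancel_right]

theorem summable_iterLim_comp {a : ℕ → ℕ} (ha : a.Injective) (x : ℝ) :
    Summable fun m => ‖iterLim F (a m) x‖ :=
  (summable_norm_iterLim hF hS x).comp_injective ha

theorem sum_norm_iterLim_comp_le {a : ℕ → ℕ} (ha : a.Injective) (x : ℝ) (N : ℕ) :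
    ∑ m ∈ Finset.range N, ‖iterLim F (a m) x‖ ≤ ∑' n, ‖iterLim F n x‖ :=
  ((summable_iterLim_comp hF hS ha x).sum_le_tsum _ fun _ _ => norm_nonneg _).trans
    (tsum_comp_le_tsum_of_inj (summable_norm_iterLim hF hS x) (fun _ => norm_nonneg _) ha)

theorem aestronglyMeasurable_tsum_iterLim {a : ℕ → ℕ} (ha : a.Injective) (μ : Measure ℝ) :
    AEStronglyMeasurable (fun x => ∑' m, iterLim F (a m) x) μ :=
  aestronglyMeasurable_of_tendsto_ae atTop (f := fun N x => ∑ m ∈ Finset.range N, iterLim F (a m) x)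
    (fun _ => Finset.aestronglyMeasurable_fun_sum _
      fun _ _ => aestronglyMeasurable_iterLim hF hS _ μ)
    (Eventually.of_forall fun x =>
      (summable_iterLim_comp hF hS ha x).of_norm.hasSum.tendsto_sum_nat)

theorem norm_tsum_iterLim_le {a : ℕ → ℕ} (ha : a.Injective) (x : ℝ) :
    ‖∑' m, iterLim F (a m) x‖ ≤ ∑' n, ‖iterLim F n x‖ :=
  (norm_tsum_le_tsum_norm (summable_iterLim_comp hF hS ha x)).trans
    (tsum_comp_le_tsum_of_inj (summable_norm_iterLim hF hS x) (fun _ => norm_nonneg _) ha)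

theorem locallyIntegrable_mul_tsum_iterLim {a : ℕ → ℕ} (ha : a.Injective) (p : ℕ) :
    LocallyIntegrable fun t => twist p (F t) * ∑' m, iterLim F (a m) t := by
  rw [locallyIntegrable_iff]
  intro k hk
  obtain ⟨c, hc⟩ := hk.bddBelow
  obtain ⟨K, hK⟩ := exists_tsum_norm_iterLim_le hF hS c
  refine Integrable.mul_bdd (c := K) ((hF.twist p).integrableOn_isCompact hk)
    (aestronglyMeasurable_tsum_iterLim hF hS ha _) ?_
  filter_upwards [ae_restrict_mem hk.measurableSet] with t ht
  exact (norm_tsum_iterLim_le hF hS ha t).trans (hK t (hc ht))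

/-- Summing the integral equations for the iterated integrals over a family of orders of
constant parity. -/
theorem integral_twist_mul_tsum_iterLim {a : ℕ → ℕ} (ha : a.Injective) {p : ℕ}
    (hap : ∀ m z, twist (a m + 1) z = twist p z) {x y : ℝ} (hxy : x ≤ y) :
    ∫ t in x..y, twist p (F t) * ∑' m, iterLim F (a m) t =
      (∑' m, iterLim F (a m + 1) x) - ∑' m, iterLim F (a m + 1) y := by
  obtain ⟨K, hK⟩ := exists_tsum_norm_iterLim_le hF hS x
  have ha' : Function.Injective fun m => a m + 1 := fun m n h => ha (Nat.succ_injective h)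
  have hm : ∀ m μ, AEStronglyMeasurable (fun t => twist p (F t) * iterLim F (a m) t)
      (volume.restrict μ) := fun m μ =>
    (hF.twist p).aestronglyMeasurable.restrict.mul (aestronglyMeasurable_iterLim hF hS _ _)
  have h1 : Tendsto (fun N => ∫ t in x..y,
      ∑ m ∈ Finset.range N, twist p (F t) * iterLim F (a m) t) atTop
      (𝓝 (∫ t in x..y, twist p (F t) * ∑' m, iterLim F (a m) t)) := by
    refine intervalIntegral.tendsto_integral_filter_of_dominated_convergence
      (fun t => ‖F t‖ * K) ?_ ?_ ((hF.norm.intervalIntegrable' x y).mul_const K) ?_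
    · exact Eventually.of_forall fun N => Finset.aestronglyMeasurable_fun_sum _ fun m _ => hm m _
    · refine Eventually.of_forall fun N => Eventually.of_forall fun t ht => ?_
      rw [Set.uIoc_of_le hxy] at ht
      rw [← Finset.mul_sum, norm_mul, norm_twist]
      exact mul_le_mul_of_nonneg_left ((norm_sum_le _ _).trans
        ((sum_norm_iterLim_comp_le hF hS ha t N).trans (hK t ht.1.le))) (norm_nonneg _)
    · refine Eventually.of_forall fun t _ => ?_
      simp only [← Finset.mul_sum]
      exact (summable_iterLim_comp hF hS ha t).of_norm.hasSum.tendsto_sum_nat.const_mul _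
  refine tendsto_nhds_unique h1 (Tendsto.congr (fun N => ?_)
    ((summable_iterLim_comp hF hS ha' x).of_norm.hasSum.tendsto_sum_nat.sub
      (summable_iterLim_comp hF hS ha' y).of_norm.hasSum.tendsto_sum_nat))
  rw [intervalIntegral.integral_finsetSum, ← Finset.sum_sub_distrib]
  · refine Finset.sum_congr rfl fun m _ => ?_
    simp only [← hap m]
    exact (integral_twist_mul_iterLim hF hS (a m) hxy).symm
  · intro m _
    refine ((hF.norm.intervalIntegrable' x y).mul_const K).mono_fun (hm m _) ?_
    filter_upwards [ae_restrict_mem measurableSet_uIoc] with t ht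
    rw [Set.uIoc_of_le hxy] at ht
    have h2 : ‖iterLim F (a m) t‖ ≤ K := ((summable_norm_iterLim hF hS t).le_tsum (a m)
      fun _ _ => norm_nonneg _).trans (hK t ht.1.le)
    rw [norm_mul, norm_twist, norm_mul, norm_norm]
    exact mul_le_mul_of_nonneg_left (h2.trans (le_abs_self K)) (norm_nonneg _)

theorem tendsto_tsum_iterLim_zero {a : ℕ → ℕ} (ha : a.Injective) :
    Tendsto (fun x => ∑' m, iterLim F (a m + 1) x) atTop (𝓝 0) := by
  rw [Metric.tendsto_atTop]
  intro ε hε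
  obtain ⟨M, -, hM⟩ := hS (ε / 2) (by positivity)
  refine ⟨M, fun x hx => ?_⟩
  rw [dist_zero_right]
  have ha' : Function.Injective fun m => a m + 1 := fun m n h => ha (Nat.succ_injective h)
  have h1 := tsum_norm_iterLim_le hF hS (x := x) (K := 1 + ε / 2)
    ((eventually_ge_atTop x).mono fun y hy => hM x y hx hy)
  rw [(summable_norm_iterLim hF hS x).tsum_eq_zero_add, iterLim_zero, norm_one] at h1
  have h2 := tsum_comp_le_tsum_of_inj ((summable_nat_add_iff 1).mpr (summable_norm_iterLim hF hS x))
    (fun _ => norm_nonneg _) ha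
  have h3 := norm_tsum_le_tsum_norm (summable_iterLim_comp hF hS ha' x)
  simp only [Function.comp_def] at h2
  linarith

end

/-- The first component of the series solution. -/
noncomputable def seriesFst (F : ℝ → ℂ) (x : ℝ) : ℂ := 1 + ∑' m : ℕ, iterLim F (2 * (m + 1)) x

/-- The second component of the series solution. -/
noncomputable def seriesSnd (F : ℝ → ℂ) (x : ℝ) : ℂ := -∑' m : ℕ, iterLim F (2 * m + 1) x

section

variable {F : ℝ → ℂ} (hF : LocallyIntegrable F) (hS : SmallAtInfinity F)
include hF hS

theorem seriesFst_eq_tsum (x : ℝ) : seriesFst F x = ∑' m : ℕ, iterLim F (2 * m) x := by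
  have hinj : Function.Injective fun m : ℕ => 2 * m := fun m n h => by simpa using h
  rw [(summable_iterLim_comp hF hS hinj x).of_norm.tsum_eq_zero_add, mul_zero, iterLim_zero,
    seriesFst]

theorem tendsto_seriesFst : Tendsto (seriesFst F) atTop (𝓝 1) := by
  have hinj : Function.Injective fun m : ℕ => 2 * m + 1 := fun m n h => by simpa using h
  simpa using! (tendsto_tsum_iterLim_zero hF hS hinj).const_add 1

theorem tendsto_seriesSnd : Tendsto (seriesSnd F) atTop (𝓝 0) := by
  have hinj : Function.Injective fun m : ℕ => 2 * m := fun m n h => by simpa using h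
  simpa using! (tendsto_tsum_iterLim_zero hF hS hinj).neg

theorem locallyIntegrable_mul_seriesSnd : LocallyIntegrable fun t => F t * seriesSnd F t := by
  have hinj : Function.Injective fun m : ℕ => 2 * m + 1 := fun m n h => by simpa using h
  have := (locallyIntegrable_mul_tsum_iterLim hF hS hinj 0).neg
  refine this.congr (Eventually.of_forall fun t => ?_)
  simp [seriesSnd]

theorem locallyIntegrable_conj_mul_seriesFst :
    LocallyIntegrable fun t => conj (F t) * seriesFst F t := by
  have hinj : Function.Injective fun m : ℕ => 2 * m := fun m n h => by simpa using h
  have := locallyIntegrable_mul_tsum_iterLim hF hS hinj 1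
  refine this.congr (Eventually.of_forall fun t => ?_)
  simp [seriesFst_eq_tsum hF hS, twist_of_odd]

theorem seriesFst_eq_integral {x : ℝ} (hx : 0 ≤ x) :
    seriesFst F x = seriesFst F 0 + ∫ t in (0 : ℝ)..x, F t * seriesSnd F t := by
  have hinj : Function.Injective fun m : ℕ => 2 * m + 1 := fun m n h => by simpa using h
  have h := integral_twist_mul_tsum_iterLim hF hS hinj (p := 0)
    (fun m z => by simp [twist, Nat.even_add_one]) hx
  simp only [twist_zero] at h
  simp only [seriesFst, seriesSnd, mul_neg, intervalIntegral.integral_neg, h]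
  simp only [mul_add, mul_one, add_assoc, Nat.reduceAdd]
  ring

theorem seriesSnd_eq_integral {x : ℝ} (hx : 0 ≤ x) :
    seriesSnd F x = seriesSnd F 0 + ∫ t in (0 : ℝ)..x, conj (F t) * seriesFst F t := by
  have hinj : Function.Injective fun m : ℕ => 2 * m := fun m n h => by simpa using h
  have h := integral_twist_mul_tsum_iterLim hF hS hinj (p := 1)
    (fun m z => by simp [twist, Nat.even_add_one]) hx
  simp only [twist_of_odd (m := 1) (by simp)] at h
  simp only [seriesFst_eq_tsum hF hS, h, seriesSnd]
  ring

end

/-! ### Absolute continuity, phases and local integrability -/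

theorem smallAtInfinity_of_limsup (𝓔 : MartingaleStructure) {F : ℝ → ℂ} (hF : LocallyIntegrable F)
    (h : limsup (fun M : ℝ => bSeminorm 𝓔 1 ((Set.Ici M).indicator F)) atTop = 0) :
    SmallAtInfinity F := by
  intro ε hε
  have hlim : ∀ᶠ β in 𝓝[>] (0 : ℝ), 2 * β + Real.exp (β ^ 2) < 1 + ε := by
    have hc : Continuous fun β : ℝ => 2 * β + Real.exp (β ^ 2) := by fun_prop
    have h0 := hc.tendsto 0
    simp only [mul_zero, zero_add, ne_eq, OfNat.ofNat_ne_zero, not_false_eq_true, zero_pow,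
      Real.exp_zero] at h0
    exact (h0.eventually_lt_const (by linarith)).filter_mono nhdsWithin_le_nhds
  obtain ⟨β, hβ, hβ0⟩ := (hlim.and eventually_mem_nhdsWithin).exists
  have hβ0' : 0 < β := hβ0
  have hev : ∀ᶠ M : ℝ in atTop,
      bSeminorm 𝓔 1 ((Set.Ici M).indicator F) < ENNReal.ofReal (β / 2) := by
    refine eventually_lt_of_limsup_lt ?_
    rw [h, ENNReal.ofReal_pos]
    positivity
  obtain ⟨M, hM⟩ := eventually_atTop.mp hev
  have hle : ∀ z ≥ M, (bSeminorm 𝓔 1 ((Set.Ici z).indicator F)).toReal ≤ β / 2 := fun z hz =>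
    ENNReal.toReal_le_of_le_ofReal (by positivity) (hM z hz).le
  refine ⟨max M 0, le_max_right _ _, fun x y hx hxy => ?_⟩
  have hMx : M ≤ x := (le_max_left _ _).trans hx
  refine (tsum_norm_iter_le 𝓔 hF ((le_max_right _ _).trans hx) hxy
    (fun z hz => (hM z (hMx.trans hz)).ne_top) (β := β) ?_).trans hβ.le
  linarith [hle x hMx, hle y (hMx.trans hxy)]

theorem locallyIntegrable_indicator_Ici {E : Type*} [NormedAddCommGroup E] {f : ℝ → E}
    (hf : ∀ b : ℝ, IntegrableOn f (Set.Icc 0 b)) :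
    LocallyIntegrable ((Set.Ici (0 : ℝ)).indicator f) := by
  rw [locallyIntegrable_iff]
  intro k hk
  obtain ⟨b, hb⟩ := hk.bddAbove
  rw [IntegrableOn, integrable_indicator_iff measurableSet_Ici, IntegrableOn,
    Measure.restrict_restrict measurableSet_Ici]
  exact (hf b).mono_set fun t ht => ⟨ht.1, hb ht.2⟩

theorem _root_.AbsolutelyContinuousOnInterval.of_dist_le {X Y : Type*} [PseudoMetricSpace X]
    [PseudoMetricSpace Y] {f : ℝ → X} {g : ℝ → Y} {a b : ℝ}
    (hg : AbsolutelyContinuousOnInterval g a b)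
    (h : ∀ s ∈ Set.uIcc a b, ∀ t ∈ Set.uIcc a b, dist (f s) (f t) ≤ dist (g s) (g t)) :
    AbsolutelyContinuousOnInterval f a b := by
  rw [absolutelyContinuousOnInterval_iff] at hg ⊢
  intro ε hε
  obtain ⟨δ, hδ, hg⟩ := hg ε hε
  refine ⟨δ, hδ, fun E hE hEδ => (Finset.sum_le_sum fun i hi => ?_).trans_lt (hg E hE hEδ)⟩
  exact h _ (hE.1 i hi).1 _ (hE.1 i hi).2

section Primitive

variable {E : Type*} [NormedAddCommGroup E] [NormedSpace ℝ E] {f φ : ℝ → E}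
  {c : E}

theorem absolutelyContinuousOnInterval_of_eq_integral (hφ : LocallyIntegrable φ)
    (hf : ∀ x, 0 ≤ x → f x = c + ∫ t in (0 : ℝ)..x, φ t) {b : ℝ} (hb : 0 ≤ b) :
    AbsolutelyContinuousOnInterval f 0 b := by
  refine AbsolutelyContinuousOnInterval.of_dist_le
    (absolutelyContinuousOnInterval_primitive hφ.norm 0 b 0) fun s hs t ht => ?_
  rw [Set.uIcc_of_le hb] at hs ht
  rw [hf s hs.1, hf t ht.1, dist_add_left, dist_eq_norm, Real.dist_eq,
    intervalIntegral.integral_interval_sub_left (hφ.intervalIntegrable' _ _)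
      (hφ.intervalIntegrable' _ _),
    intervalIntegral.integral_interval_sub_left (hφ.norm.intervalIntegrable' _ _)
      (hφ.norm.intervalIntegrable' _ _)]
  exact intervalIntegral.norm_integral_le_abs_integral_norm

theorem ae_hasDerivAt_of_eq_integral [CompleteSpace E] (hφ : LocallyIntegrable φ)
    (hf : ∀ x, 0 ≤ x → f x = c + ∫ t in (0 : ℝ)..x, φ t) :
    ∀ᵐ x : ℝ, 0 < x → HasDerivAt f (φ x) x := by
  filter_upwards [_root_.LocallyIntegrable.ae_hasDerivAt_integral hφ] with x hx hx0
  refine ((hx 0).const_add c).congr_of_eventuallyEq ?_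
  filter_upwards [Ioi_mem_nhds hx0] with y hy
  exact hf y (le_of_lt hy)

end Primitive

theorem dist_exp_I_mul_le (a b : ℝ) :
    dist (Complex.exp (Complex.I * a)) (Complex.exp (Complex.I * b)) ≤ dist a b := by
  have h : Complex.exp (Complex.I * a) - Complex.exp (Complex.I * b) =
      Complex.exp (Complex.I * b) * (Complex.exp (Complex.I * (a - b : ℝ)) - 1) := by
    rw [mul_sub, ← Complex.exp_add, mul_one]
    push_cast
    ring_nf
  rw [dist_eq_norm, h, norm_mul, Complex.norm_exp_I_mul_ofReal, one_mul, Real.dist_eq]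
  exact Real.norm_exp_I_mul_ofReal_sub_one_le

theorem IsEigensolution.const_mul {σ τ : ℝ → ℝ} {E : ℝ} {u v : ℝ → ℂ}
    (h : IsEigensolution σ τ E u v) (c : ℂ) :
    IsEigensolution σ τ E (fun x => c * u x) (fun x => c * v x) where
  ac b hb := (h.ac b hb).const_smul c
  ac_quasi b hb := (h.ac_quasi b hb).const_smul c
  quasi_eq := by
    filter_upwards [h.quasi_eq] with x hx hx0
    rw [deriv_const_mul_field', hx hx0]
    ring
  eigen_eq := by
    filter_upwards [h.eigen_eq] with x hx hx0
    rw [deriv_const_mul_field']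
    linear_combination c * hx hx0

/-- Two potentials whose primitives differ by a convergent quantity have the same phase
asymptotics, up to a constant phase. -/
theorem HasPhaseAsymptotics.of_tendsto {ρ ρ' : ℝ → ℝ} {E L : ℝ} {u v : ℝ → ℂ}
    (h : HasPhaseAsymptotics ρ E u v)
    (hL : Tendsto (fun x => (∫ t in (0 : ℝ)..x, ρ' t) - ∫ t in (0 : ℝ)..x, ρ t) atTop (𝓝 L)) :
    HasPhaseAsymptotics ρ' E
      (fun x => Complex.exp (Complex.I * ((-(L / (2 * √E)) : ℝ) : ℂ)) * u x)
      (fun x => Complex.exp (Complex.I * ((-(L / (2 * √E)) : ℝ) : ℂ)) * v x) := by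
  set c := Complex.exp (Complex.I * ((-(L / (2 * √E)) : ℝ) : ℂ)) with hc
  set w : (ℝ → ℝ) → ℝ → ℂ := fun r x =>
    Complex.exp (Complex.I * (√E * x : ℝ) - Complex.I / (2 * (√E : ℝ)) *
      ((∫ t in (0 : ℝ)..x, r t : ℝ) : ℂ)) with hw
  have hnorm : ∀ r x, ‖w r x‖ = 1 := by
    intro r x
    have : w r x = Complex.exp (Complex.I *
        ((√E * x - (∫ t in (0 : ℝ)..x, r t) / (2 * √E) : ℝ) : ℂ)) := by
      simp only [hw]; congr 1; push_cast; ring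
    rw [this, Complex.norm_exp_I_mul_ofReal]
  set d : ℝ → ℂ := fun x => Complex.exp (Complex.I *
    ((-(((∫ t in (0 : ℝ)..x, ρ' t) - ∫ t in (0 : ℝ)..x, ρ t) / (2 * √E)) : ℝ) : ℂ)) with hd
  have hwd : ∀ x, w ρ' x = w ρ x * d x := by
    intro x
    simp only [hw, hd, ← Complex.exp_add]
    congr 1; push_cast; ring
  have hlim : Tendsto d atTop (𝓝 c) := by
    have : Continuous fun s : ℝ => Complex.exp (Complex.I * ((-(s / (2 * √E)) : ℝ) : ℂ)) := by
      fun_prop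
    exact (this.tendsto L).comp hL
  have hdiff : Tendsto (fun x => w ρ x * (c - d x)) atTop (𝓝 0) := by
    rw [tendsto_zero_iff_norm_tendsto_zero]
    simp only [norm_mul, hnorm, one_mul]
    simpa using ((tendsto_const_nhds (x := c)).sub hlim).norm
  constructor
  · have := (h.1.const_mul c).add hdiff
    simp only [mul_zero, add_zero] at this
    refine this.congr fun x => ?_
    change c * (u x - w ρ x) + w ρ x * (c - d x) = c * u x - w ρ' x
    rw [hwd]; ring
  · have := (h.2.const_mul c).add (hdiff.const_mul (Complex.I * (√E : ℝ)))
    simp only [mul_zero, add_zero] at this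
    refine this.congr fun x => ?_
    change c * (v x - Complex.I * (√E : ℝ) * w ρ x) +
      Complex.I * (√E : ℝ) * (w ρ x * (c - d x)) = c * v x - Complex.I * (√E : ℝ) * w ρ' x
    rw [hwd]; ring

section Eigensolution

variable {σ τ : ℝ → ℝ} (hσ : ∀ b : ℝ, MemLp σ 2 (volume.restrict (Set.Icc 0 b)))
  (hτ : ∀ b : ℝ, IntegrableOn τ (Set.Icc 0 b)) {E : ℝ}
include hσ

theorem integrableOn_sq (b : ℝ) : IntegrableOn (fun t => σ t ^ 2) (Set.Icc 0 b) :=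
  (hσ b).integrable_sq

include hτ

theorem integrableOn_Q (b : ℝ) : IntegrableOn (Q σ τ) (Set.Icc 0 b) :=
  (hτ b).sub (integrableOn_sq hσ b)

theorem h_eq_integral {x : ℝ} (hx : 0 ≤ x) : h σ τ E x =
    0 + ∫ t in (0 : ℝ)..x, (2 * √E - (Set.Ici (0 : ℝ)).indicator (Q σ τ) t / √E) := by
  have hq := locallyIntegrable_indicator_Ici (integrableOn_Q hσ hτ)
  rw [intervalIntegral.integral_sub intervalIntegrable_const
    ((hq.intervalIntegrable' _ _).div_const _), intervalIntegral.integral_const, h, zero_add]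
  congr 1
  · simp; ring
  · refine intervalIntegral.integral_congr fun t ht => ?_
    rw [Set.uIcc_of_le hx] at ht
    simp only [Set.indicator_of_mem (show t ∈ Set.Ici (0 : ℝ) from ht.1)]

theorem locallyIntegrable_deriv_h : LocallyIntegrable fun t =>
    2 * √E - (Set.Ici (0 : ℝ)).indicator (Q σ τ) t / √E := by
  have hq := locallyIntegrable_indicator_Ici (integrableOn_Q hσ hτ)
  refine (locallyIntegrable_const (2 * √E)).sub ?_
  exact (hq.smul (√E)⁻¹).congr (Eventually.of_forall fun t => by simp; ring)

theorem absolutelyContinuous_h {b : ℝ} (hb : 0 ≤ b) :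
    AbsolutelyContinuousOnInterval (h σ τ E) 0 b :=
  absolutelyContinuousOnInterval_of_eq_integral (locallyIntegrable_deriv_h hσ hτ)
    (fun _ hx => h_eq_integral hσ hτ hx) hb

theorem ae_hasDerivAt_h :
    ∀ᵐ x : ℝ, 0 < x → HasDerivAt (h σ τ E) (2 * √E - Q σ τ x / √E) x := by
  filter_upwards [ae_hasDerivAt_of_eq_integral (locallyIntegrable_deriv_h (E := E) hσ hτ)
    (fun _ hx => h_eq_integral hσ hτ hx)] with x hx hx0
  have := hx hx0
  rwa [Set.indicator_of_mem (show x ∈ Set.Ici (0 : ℝ) from hx0.le)] at this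

theorem acLoc_exp_I_mul (s : ℝ) (hs : |s| ≤ 1) :
    ACLoc fun x => Complex.exp (Complex.I * (s * h σ τ E x : ℝ)) := fun b hb => by
  refine AbsolutelyContinuousOnInterval.of_dist_le (absolutelyContinuous_h (E := E) hσ hτ hb)
    fun x _ y _ => (dist_exp_I_mul_le _ _).trans ?_
  rw [Real.dist_eq, Real.dist_eq, ← mul_sub, abs_mul]
  exact mul_le_of_le_one_left (abs_nonneg _) hs

theorem integrableOn_calF (b : ℝ) : IntegrableOn (calF σ τ E) (Set.Icc 0 b) := by
  rcases lt_or_ge b 0 with hb | hb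
  · simp [Set.Icc_eq_empty (not_le.mpr hb)]
  have hQt : IntegrableOn (Qtilde σ τ E) (Set.Icc 0 b) :=
    (integrableOn_Q hσ hτ b).ofReal.add (((hσ b).integrable (by norm_num)).ofReal.const_mul _)
  have hcont : ContinuousOn (fun x => -(Complex.I / (2 * (√E : ℝ))) *
      Complex.exp (-(Complex.I * (h σ τ E x : ℝ)))) (Set.Icc 0 b) := by
    have := (absolutelyContinuous_h (E := E) hσ hτ hb).continuousOn
    rw [Set.uIcc_of_le hb] at this
    fun_prop
  exact hQt.continuousOn_mul hcont isCompact_Icc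

theorem locallyIntegrable_indicator_calF :
    LocallyIntegrable ((Set.Ici (0 : ℝ)).indicator (calF σ τ E)) :=
  locallyIntegrable_indicator_Ici (integrableOn_calF hσ hτ)

end Eigensolution

/-! ### The eigensolution -/

section Eigensolution

variable {σ τ : ℝ → ℝ} (hσ : ∀ b : ℝ, MemLp σ 2 (volume.restrict (Set.Icc 0 b)))
  (hτ : ∀ b : ℝ, IntegrableOn τ (Set.Icc 0 b)) {E : ℝ}
include hσ hτ

theorem solvesSystem_series
    (hS : SmallAtInfinity ((Set.Ici (0 : ℝ)).indicator (calF σ τ E))) :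
    SolvesSystem (calF σ τ E) (seriesFst ((Set.Ici (0 : ℝ)).indicator (calF σ τ E)))
      (seriesSnd ((Set.Ici (0 : ℝ)).indicator (calF σ τ E))) := by
  have hF := locallyIntegrable_indicator_calF (E := E) hσ hτ
  have hind : ∀ x : ℝ, 0 < x → (Set.Ici (0 : ℝ)).indicator (calF σ τ E) x = calF σ τ E x :=
    fun x hx => Set.indicator_of_mem (show x ∈ Set.Ici (0 : ℝ) from hx.le) _
  refine ⟨fun b hb => ?_, fun b hb => ?_, ?_, ?_⟩
  · exact absolutelyContinuousOnInterval_of_eq_integral (locallyIntegrable_mul_seriesSnd hF hS)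
      (fun _ hx => seriesFst_eq_integral hF hS hx) hb
  · exact absolutelyContinuousOnInterval_of_eq_integral
      (locallyIntegrable_conj_mul_seriesFst hF hS) (fun _ hx => seriesSnd_eq_integral hF hS hx) hb
  · filter_upwards [ae_hasDerivAt_of_eq_integral (locallyIntegrable_mul_seriesSnd hF hS)
      (fun _ hx => seriesFst_eq_integral hF hS hx)] with x hx hx0
    rw [(hx hx0).deriv, hind x hx0]
  · filter_upwards [ae_hasDerivAt_of_eq_integral (locallyIntegrable_conj_mul_seriesFst hF hS)
      (fun _ hx => seriesSnd_eq_integral hF hS hx)] with x hx hx0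
    rw [(hx hx0).deriv, hind x hx0]

end Eigensolution

theorem ACLoc.mul {f g : ℝ → ℂ} (hf : ACLoc f) (hg : ACLoc g) : ACLoc fun x => f x * g x :=
  fun b hb => (hf b hb).fun_smul (hg b hb)

theorem ACLoc.add {f g : ℝ → ℂ} (hf : ACLoc f) (hg : ACLoc g) : ACLoc fun x => f x + g x :=
  fun b hb => (hf b hb).fun_add (hg b hb)

theorem ACLoc.sub {f g : ℝ → ℂ} (hf : ACLoc f) (hg : ACLoc g) : ACLoc fun x => f x - g x :=
  fun b hb => (hf b hb).fun_sub (hg b hb)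

theorem ACLoc.const_mul {f : ℝ → ℂ} (hf : ACLoc f) (c : ℂ) : ACLoc fun x => c * f x :=
  fun b hb => (hf b hb).const_smul c

/-- A locally absolutely continuous complex function is almost everywhere differentiable. -/
theorem ACLoc.ae_differentiableAt {f : ℝ → ℂ} (hf : ACLoc f) :
    ∀ᵐ x : ℝ, 0 < x → DifferentiableAt ℝ f x := by
  have hre : ∀ n : ℕ, ∀ᵐ x : ℝ, x ∈ Set.uIcc 0 (n : ℝ) →
      DifferentiableAt ℝ (fun x => (f x).re) x := fun n =>
    ((hf n n.cast_nonneg).of_dist_le fun s _ t _ => by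
      rw [Real.dist_eq, Complex.dist_eq, ← Complex.sub_re]
      exact Complex.abs_re_le_norm _).ae_differentiableAt
  have him : ∀ n : ℕ, ∀ᵐ x : ℝ, x ∈ Set.uIcc 0 (n : ℝ) →
      DifferentiableAt ℝ (fun x => (f x).im) x := fun n =>
    ((hf n n.cast_nonneg).of_dist_le fun s _ t _ => by
      rw [Real.dist_eq, Complex.dist_eq, ← Complex.sub_im]
      exact Complex.abs_im_le_norm _).ae_differentiableAt
  filter_upwards [ae_all_iff.mpr hre, ae_all_iff.mpr him] with x h1 h2 hx
  obtain ⟨n, hn⟩ := exists_nat_ge x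
  have hmem : x ∈ Set.uIcc 0 (n : ℝ) := by rw [Set.uIcc_of_le n.cast_nonneg]; exact ⟨hx.le, hn⟩
  have h3 : DifferentiableAt ℝ (fun x => ((f x).re : ℂ) + ((f x).im : ℂ) * Complex.I) x :=
    ((h1 n hmem).hasDerivAt.ofReal_comp.differentiableAt).add
      ((h2 n hmem).hasDerivAt.ofReal_comp.differentiableAt.mul_const _)
  simpa only [Complex.re_add_im] using h3

section Eigensolution

variable {σ τ : ℝ → ℝ} (hσ : ∀ b : ℝ, MemLp σ 2 (volume.restrict (Set.Icc 0 b)))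
  (hτ : ∀ b : ℝ, IntegrableOn τ (Set.Icc 0 b)) {E : ℝ} {Y₁ Y₂ : ℝ → ℂ}

/-- The eigensolution built from a solution of the first-order system. -/
noncomputable def eigenfun (σ τ : ℝ → ℝ) (E : ℝ) (Y₁ Y₂ : ℝ → ℂ) (x : ℝ) : ℂ :=
  Complex.exp (Complex.I * (h σ τ E x / 2 : ℝ)) * Y₁ x +
    Complex.exp (-(Complex.I * (h σ τ E x / 2 : ℝ))) * Y₂ x

/-- The quasiderivative of `eigenfun`. -/
noncomputable def eigenquasi (σ τ : ℝ → ℝ) (E : ℝ) (Y₁ Y₂ : ℝ → ℂ) (x : ℝ) : ℂ :=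
  Complex.I * (√E : ℝ) * (Complex.exp (Complex.I * (h σ τ E x / 2 : ℝ)) * Y₁ x -
    Complex.exp (-(Complex.I * (h σ τ E x / 2 : ℝ))) * Y₂ x)

theorem exp_mul_calF (x : ℝ) : Complex.exp (Complex.I * (h σ τ E x / 2 : ℝ)) * calF σ τ E x =
    -(Complex.I / (2 * (√E : ℝ))) * Complex.exp (-(Complex.I * (h σ τ E x / 2 : ℝ))) *
      Qtilde σ τ E x := by
  have : Complex.exp (-(Complex.I * (h σ τ E x / 2 : ℝ))) =
      Complex.exp (Complex.I * (h σ τ E x / 2 : ℝ)) *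
        Complex.exp (-(Complex.I * (h σ τ E x : ℝ))) := by
    rw [← Complex.exp_add]; congr 1; push_cast; ring
  rw [calF, this]; ring

theorem exp_mul_conj_calF (x : ℝ) :
    Complex.exp (-(Complex.I * (h σ τ E x / 2 : ℝ))) * conj (calF σ τ E x) =
    Complex.I / (2 * (√E : ℝ)) * Complex.exp (Complex.I * (h σ τ E x / 2 : ℝ)) *
      conj (Qtilde σ τ E x) := by
  have := congrArg conj (exp_mul_calF (σ := σ) (τ := τ) (E := E) x)
  simp only [map_mul, map_neg, map_div₀, ← Complex.exp_conj, Complex.conj_I, Complex.conj_ofReal,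
    map_ofNat, neg_mul, neg_div, neg_neg] at this
  rw [this]

include hσ hτ in
theorem isEigensolution_eigenfun (hE : 0 < E) (hY : SolvesSystem (calF σ τ E) Y₁ Y₂) :
    IsEigensolution σ τ E (eigenfun σ τ E Y₁ Y₂) (eigenquasi σ τ E Y₁ Y₂) := by
  have hk : ((√E : ℝ) : ℂ) ≠ 0 := Complex.ofReal_ne_zero.mpr (Real.sqrt_pos.mpr hE).ne'
  have hkE : ((√E : ℝ) : ℂ) ^ 2 = E := by
    rw [← Complex.ofReal_pow, Real.sq_sqrt hE.le]
  have hplus : ACLoc fun x => Complex.exp (Complex.I * (h σ τ E x / 2 : ℝ)) := by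
    have := acLoc_exp_I_mul (E := E) hσ hτ (1 / 2) (by rw [abs_of_nonneg] <;> norm_num)
    simpa only [one_div_mul_eq_div] using this
  have hminus : ACLoc fun x => Complex.exp (-(Complex.I * (h σ τ E x / 2 : ℝ))) := by
    have := acLoc_exp_I_mul (E := E) hσ hτ (-(1 / 2)) (by rw [abs_neg, abs_of_nonneg] <;> norm_num)
    simpa only [neg_mul, one_div_mul_eq_div, Complex.ofReal_neg, mul_neg] using this
  have hdiff : ∀ᵐ x : ℝ, 0 < x →
      deriv (eigenfun σ τ E Y₁ Y₂) x = eigenquasi σ τ E Y₁ Y₂ x + σ x * eigenfun σ τ E Y₁ Y₂ x ∧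
      deriv (eigenquasi σ τ E Y₁ Y₂) x =
        ((Q σ τ x : ℝ) - E : ℂ) * eigenfun σ τ E Y₁ Y₂ x - σ x * eigenquasi σ τ E Y₁ Y₂ x := by
    filter_upwards [hY.ac_fst.ae_differentiableAt, hY.ac_snd.ae_differentiableAt, hY.deriv_fst,
      hY.deriv_snd, ae_hasDerivAt_h (E := E) hσ hτ] with x d1 d2 e1 e2 dh hx
    have D1 := (d1 hx).hasDerivAt
    have D2 := (d2 hx).hasDerivAt
    rw [e1 hx] at D1
    rw [e2 hx] at D2
    have Dh := (((dh hx).div_const 2).ofReal_comp).const_mul Complex.I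
    have Dp := Dh.cexp.mul D1
    have Dm := Dh.neg.cexp.mul D2
    have F1 := exp_mul_calF (σ := σ) (τ := τ) (E := E) x
    have F2 := exp_mul_conj_calF (σ := σ) (τ := τ) (E := E) x
    have hQt : conj (Qtilde σ τ E x) =
        (Q σ τ x : ℂ) - 2 * Complex.I * (√E : ℝ) * (σ x : ℂ) := by
      simp [Qtilde, map_ofNat]; ring
    rw [hQt] at F2
    rw [Qtilde] at F1
    have hI := Complex.I_sq
    have hI3 : Complex.I ^ 3 = -Complex.I := by rw [pow_succ, hI]; ring
    constructor
    · refine (Dp.add Dm).deriv.trans ?_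
      simp only [Pi.neg_apply, ← mul_assoc, F1, F2, eigenfun, eigenquasi]
      set p := Complex.exp (Complex.I * (h σ τ E x / 2 : ℝ))
      set m := Complex.exp (-(Complex.I * (h σ τ E x / 2 : ℝ)))
      push_cast
      field_simp
      ring_nf
      simp only [hI]
      ring
    · refine ((Dp.sub Dm).const_mul (Complex.I * (√E : ℝ))).deriv.trans ?_
      simp only [Pi.neg_apply, ← mul_assoc, F1, F2, eigenfun, eigenquasi, ← hkE]
      set p := Complex.exp (Complex.I * (h σ τ E x / 2 : ℝ))
      set m := Complex.exp (-(Complex.I * (h σ τ E x / 2 : ℝ)))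
      push_cast
      field_simp
      ring_nf
      simp only [hI, hI3]
      ring
  refine ⟨?_, ?_, ?_, ?_⟩
  · exact (hplus.mul hY.ac_fst).add (hminus.mul hY.ac_snd)
  · exact ((hplus.mul hY.ac_fst).sub (hminus.mul hY.ac_snd)).const_mul _
  · filter_upwards [hdiff] with x hx hx0
    rw [(hx hx0).1]; ring
  · filter_upwards [hdiff] with x hx hx0
    rw [(hx hx0).2, Q]; ring

theorem hasPhaseAsymptotics_eigenfun (h₁ : Tendsto Y₁ atTop (𝓝 1)) (h₂ : Tendsto Y₂ atTop (𝓝 0)) :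
    HasPhaseAsymptotics (Q σ τ) E (eigenfun σ τ E Y₁ Y₂) (eigenquasi σ τ E Y₁ Y₂) := by
  have hphase : ∀ x : ℝ, Complex.exp (Complex.I * (√E * x : ℝ) - Complex.I / (2 * (√E : ℝ)) *
      ((∫ t in (0 : ℝ)..x, Q σ τ t : ℝ) : ℂ)) = Complex.exp (Complex.I * (h σ τ E x / 2 : ℝ)) := by
    intro x
    rw [h, intervalIntegral.integral_div]
    congr 1; push_cast; ring
  have hbdd : ∀ {w : ℝ → ℂ} {g : ℝ → ℂ}, (∀ x, ‖w x‖ = 1) → Tendsto g atTop (𝓝 0) →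
      Tendsto (fun x => w x * g x) atTop (𝓝 0) := by
    intro w g hw hg
    rw [tendsto_zero_iff_norm_tendsto_zero] at hg ⊢
    simpa only [norm_mul, hw, one_mul] using hg
  have hp : Tendsto (fun x => Complex.exp (Complex.I * (h σ τ E x / 2 : ℝ)) * (Y₁ x - 1))
      atTop (𝓝 0) :=
    hbdd (fun x => Complex.norm_exp_I_mul_ofReal _) (by simpa using h₁.sub_const 1)
  have hm : Tendsto (fun x => Complex.exp (-(Complex.I * (h σ τ E x / 2 : ℝ))) * Y₂ x)
      atTop (𝓝 0) := by
    refine hbdd (fun x => ?_) h₂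
    rw [← mul_neg, ← Complex.ofReal_neg, Complex.norm_exp_I_mul_ofReal]
  constructor
  · have := hp.add hm
    rw [add_zero] at this
    refine this.congr fun x => ?_
    rw [hphase, eigenfun]; ring
  · have := (hp.sub hm).const_mul (Complex.I * (√E : ℝ))
    rw [sub_zero, mul_zero] at this
    refine this.congr fun x => ?_
    rw [hphase, eigenquasi]; ring

include hσ hτ in
theorem tendsto_integral_tau_sub_Q (hσ' : MemLp σ 2 (volume.restrict (Set.Ici 0))) :
    Tendsto (fun x => (∫ t in (0 : ℝ)..x, τ t) - ∫ t in (0 : ℝ)..x, Q σ τ t) atTop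
      (𝓝 (∫ t in Set.Ioi (0 : ℝ), σ t ^ 2)) := by
  have hint : IntegrableOn (fun t => σ t ^ 2) (Set.Ioi 0) :=
    IntegrableOn.mono_set (t := Set.Ici 0) hσ'.integrable_sq Set.Ioi_subset_Ici_self
  refine (intervalIntegral_tendsto_integral_Ioi 0 hint tendsto_id).congr' ?_
  filter_upwards [eventually_ge_atTop 0] with x hx
  have h1 : IntervalIntegrable τ volume 0 x :=
    (intervalIntegrable_iff_integrableOn_Icc_of_le hx).mpr (hτ x)
  have h2 : IntervalIntegrable (fun t => σ t ^ 2) volume 0 x :=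
    (intervalIntegrable_iff_integrableOn_Icc_of_le hx).mpr (integrableOn_sq hσ x)
  simp only [Q, id]
  rw [intervalIntegral.integral_sub h1 h2]
  ring

end Eigensolution

end WKB


theorem mainTheorem5 (σ τ : ℝ → ℝ)
    (hσ : ∀ b : ℝ, MemLp σ 2 (volume.restrict (Set.Icc 0 b)))
    (hτ : ∀ b : ℝ, IntegrableOn τ (Set.Icc 0 b))
    (E : ℝ) (hE : 0 < E) (𝓔 : WKB.MartingaleStructure)
    (htail : limsup (fun M : ℝ =>
      WKB.bSeminorm 𝓔 1 ((Set.Ici M).indicator (WKB.calF σ τ E))) atTop = 0) :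
    ∃ (B : ℕ → ℝ → ℂ) (Y₁ Y₂ u v : ℝ → ℂ),
      -- `B n x` is the value `M_n(𝓕)(x, ∞, E)`
      (∀ n x, 0 ≤ x → Tendsto (fun x' : ℝ => WKB.multilinearAlt (WKB.calF σ τ E) n x x')
        atTop (𝓝 (B n x))) ∧
      -- absolute convergence of the series
      (∀ x, 0 ≤ x → Summable (fun n : ℕ => ‖B n x‖)) ∧
      -- the series solution of the first-order system
      (∀ x, Y₁ x = 1 + ∑' m : ℕ, B (2 * (m + 1)) x) ∧
      (∀ x, Y₂ x = -∑' m : ℕ, B (2 * m + 1) x) ∧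
      WKB.SolvesSystem (WKB.calF σ τ E) Y₁ Y₂ ∧
      Tendsto Y₁ atTop (𝓝 1) ∧ Tendsto Y₂ atTop (𝓝 0) ∧
      -- the eigensolution obtained from it
      (∀ x, u x = Complex.exp (Complex.I * (WKB.h σ τ E x / 2 : ℝ)) * Y₁ x +
        Complex.exp (-(Complex.I * (WKB.h σ τ E x / 2 : ℝ))) * Y₂ x) ∧
      (∀ x, v x = Complex.I * (√E : ℝ) *
        (Complex.exp (Complex.I * (WKB.h σ τ E x / 2 : ℝ)) * Y₁ x -
          Complex.exp (-(Complex.I * (WKB.h σ τ E x / 2 : ℝ))) * Y₂ x)) ∧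
      WKB.IsEigensolution σ τ E u v ∧
      WKB.HasPhaseAsymptotics (WKB.Q σ τ) E u v ∧
      -- WKB asymptotic behavior, after normalization by a constant phase
      (MemLp σ 2 (volume.restrict (Set.Ici 0)) →
        ∃ c : ℂ, ‖c‖ = 1 ∧
          WKB.IsEigensolution σ τ E (fun x => c * u x) (fun x => c * v x) ∧
          WKB.HasWKBAsymptotics τ E (fun x => c * u x) (fun x => c * v x)) := by
  -- nothing is assumed about `σ` and `τ` on the negative half-line; cutting off there makes
  -- the coefficient locally integrable on the whole line without changing anything else
  set F : ℝ → ℂ := (Set.Ici (0 : ℝ)).indicator (WKB.calF σ τ E) with hFdef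
  have hF : LocallyIntegrable F := WKB.locallyIntegrable_indicator_calF hσ hτ
  have hS : WKB.SmallAtInfinity F := by
    refine WKB.smallAtInfinity_of_limsup 𝓔 hF ((limsup_congr ?_).trans htail)
    filter_upwards [eventually_ge_atTop 0] with M hM
    rw [hFdef, Set.indicator_indicator,
      Set.inter_eq_self_of_subset_left (Set.Ici_subset_Ici.mpr hM)]
  have hY := WKB.solvesSystem_series hσ hτ hS
  have h₁ := WKB.tendsto_seriesFst hF hS
  have h₂ := WKB.tendsto_seriesSnd hF hS
  have hu := WKB.isEigensolution_eigenfun hσ hτ hE hY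
  have hasym := WKB.hasPhaseAsymptotics_eigenfun (σ := σ) (τ := τ) (E := E) h₁ h₂
  refine ⟨WKB.iterLim F, WKB.seriesFst F, WKB.seriesSnd F,
    WKB.eigenfun σ τ E (WKB.seriesFst F) (WKB.seriesSnd F),
    WKB.eigenquasi σ τ E (WKB.seriesFst F) (WKB.seriesSnd F), ?_,
    fun x _ => WKB.summable_norm_iterLim hF hS x, fun _ => rfl, fun _ => rfl, hY, h₁, h₂,
    fun _ => rfl, fun _ => rfl, hu, hasym, fun hσ' => ?_⟩
  · intro n x hx
    refine (WKB.tendsto_iterLim hF hS n x).congr' ?_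
    filter_upwards [eventually_ge_atTop x] with y hxy
    rw [← WKB.multilinearAlt_eq_iter hF n hxy]
    refine setIntegral_congr_fun (WKB.measurableSet_simplex n x y) fun t ht => ?_
    refine Finset.prod_congr rfl fun i _ => ?_
    have : t i ∈ Set.Ici (0 : ℝ) := hx.trans (ht.2 i).1
    simp only [WKB.alternating, hFdef, Set.indicator_of_mem this]
  · exact ⟨_, Complex.norm_exp_I_mul_ofReal _, hu.const_mul _,
      hasym.of_tendsto (WKB.tendsto_integral_tau_sub_Q hσ hτ hσ')⟩
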